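/- Let $V$ be a finite-dimensional real Euclidean space with inner product $\langle-,-\rangle$. For a real vector space with a symmetric bilinear form and a vector $\alpha$ of non-zero norm, the reflection in $\alpha$ is $v\mapsto v-\langle v,\alpha^\vee\rangle\alpha$, $\alpha^\vee=\frac{2}{\langle\alpha,\alpha\rangle}\alpha$. A *root system* is a finite set of non-zero vectors that is stable under the reflections in its elements and contains no multiples $c\alpha$ of an element $\alpha$ other than $\pm\alpha$. A *simple system* of a root system $\Phi$ is a linearly independent subset $\Pi$ of $\Phi$ such that $\Phi=\Phi_+\,\dot\cup\,(-\Phi_+)$, where $\Phi_+=\Phi\cap\mathbb R_{\ge0}\Pi$. A *root subsystem* of $\Phi$ is a subset of $\Phi$ that is a root system, and a *simple subsystem* of $\Phi$ is a simple system of some root subsystem of $\Phi$. The Coxeter graph of a simple system is defined by the orders of the products of two of its reflections; a component is *simply laced* if these orders, for distinct elements of the component, are all $2$ or $3$. Let $\tau=\frac{1+\sqrt5}{2}$ and $R=\mathbb Z[\tau]$, and let $\theta\colon R\to\mathbb Z$ be given by $\theta(a+b\tau)=a$ for $a,b\in\mathbb Z$. Let $\Phi\subseteq V$ be a root system with a simple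 system $\Pi$ such that $\langle\alpha,\alpha\rangle=2$ for $\alpha\in\Pi$ and $\langle\alpha,\beta\rangle\in\{0,-1,-\tau\}$ for distinct $\alpha,\beta\in\Pi$, and let $W$ be the group generated by the reflections in $\Phi$. Let $U=R\Pi$, which contains $\Phi$ and is stable under $W$, and on which $\langle-,-\rangle$ takes values in $R$. Equip $U$ with the $\mathbb Z$-bilinear form $(u,v)=\theta(\langle u,v\rangle)$, and extend this form and the action of $W$ linearly to $\mathbb R\otimes_{\mathbb Z}U\supseteq U$. Then $(-,-)$ is positive definite, the union $\Psi:=\Phi\cup\tau\Phi$ is disjoint, and $\Psi$ is a simply laced crystallographic root system in $\mathbb R\otimes_{\mathbb Z}U$ with simple system $\Pi\cup\tau\Pi$ and with $(\alpha,\alpha)=2$ for all $\alpha\in\Psi$. A *bundle* is a set $\{\alpha,\tau\alpha\}$ with $\alpha\in\Phi$. Moreover: (a) The map $\Gamma\mapsto\Gamma\cup\tau\Gamma$ restricts to a $W$-equivariant bijection $\varphi$ from the set of simple subsystems of $\Phi$ to the set of simple subsystems of $\Psi$ that are unions of bundles. (b) Let $\Gamma$ be a simple subsystem of $\Phi$,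 let $\Gamma'=\varphi(\Gamma)$ and let $\alpha\in\Phi$. Let $\mathcal C_{W_\Gamma}=\{v\in V:\langle v,\gamma\rangle\ge0\text{ for all }\gamma\in\Gamma\}$ and $\mathcal C_{W'_{\Gamma'}}=\{v\in\mathbb R\otimes_{\mathbb Z}U:(v,\gamma)\ge0\text{ for all }\gamma\in\Gamma'\}$ be the closed fundamental chambers. Then $\alpha\in\mathcal C_{W_\Gamma}$ if and only if $\tau\alpha\in\mathcal C_{W'_{\Gamma'}}$. (c) Let $\Gamma$ be a simple subsystem of $\Phi$ and $\Gamma'=\varphi(\Gamma)$. The Coxeter graph of $\Gamma'$ is obtained from that of $\Gamma$ by replacing each component of type $H_4$ (resp. $H_3$, $I_2(5)$) by one of type $E_8$ (resp. $D_6$, $A_4$) and each simply laced component by two components of the same type. More precisely, every component $C$ of the Coxeter graph of $\Gamma$ is of type $H_4$, $H_3$ or $I_2(5)$, or simply laced; if $C$ is of type $H_4$ (resp. $H_3$, $I_2(5)$), then $C\cup\tau C$ is a component of the Coxeter graph of $\Gamma'$, of type $E_8$ (resp. $D_6$, $A_4$); and if $C$ is simply laced, then $C$ and $\tau C$ are two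 distinct components of the Coxeter graph of $\Gamma'$, both of the same type as $C$. (d) The map $\varphi$ induces a $W$-equivariant bijection $\varphi'$ from the set of root subsystems of $\Phi$ to the set of root subsystems of $\Psi$ that are unions of bundles, with $\varphi'(\Lambda)=\Lambda\cup\tau\Lambda$; if $\Gamma$ is a simple system of $\Lambda$, then $\varphi(\Gamma)$ is a simple system of $\varphi'(\Lambda)$. -/

import Mathlib

open scoped TensorProduct NNReal goldenRatio

noncomputable section

namespace GoldenFolding

/-! ### Root systems, simple systems and Coxeter graphs in a real space with a bilinear form -/

section RootSystems

variable {E : Type*} [AddCommGroup E] [Module ℝ E] (B : LinearMap.BilinForm ℝ E)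

/-- The reflection `v ↦ v - B(v, α^∨) α`, where `α^∨ = (2 / B(α, α)) α`. -/
def reflection (α : E) : Module.End ℝ E :=
  LinearMap.id - (B.flip ((2 / B α α) • α)).smulRight α

theorem reflection_apply (α v : E) :
    reflection B α v = v - (2 / B α α * B v α) • α := by
  simp [reflection]

/-- A (reduced, finite) root system with respect to the form `B`. -/
structure IsRootSystem (Φ : Set E) : Prop where
  finite : Φ.Finite
  zero_notMem : (0 : E) ∉ Φ
  reflection_mem : ∀ α ∈ Φ, ∀ β ∈ Φ, reflection B α β ∈ Φ
  reduced : ∀ α ∈ Φ, ∀ c : ℝ, c • α ∈ Φ → c = 1 ∨ c = -1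

/-- The roots of `Φ` which are non-negative real linear combinations of `Γ`. -/
def positivePart (Φ Γ : Set E) : Set E :=
  Φ ∩ (Submodule.span ℝ≥0 Γ : Set E)

/-- `Γ` is a simple system of `Φ`: it is a linearly independent subset of `Φ`, and `Φ` is the
disjoint union of `Φ₊` and `-Φ₊`, where `Φ₊` consists of the roots in the cone spanned by `Γ`. -/
structure IsSimpleSystem (Φ Γ : Set E) : Prop where
  subset : Γ ⊆ Φ
  linearIndepOn : LinearIndepOn ℝ id Γ
  eq_union : Φ = positivePart Φ Γ ∪ {v | -v ∈ positivePart Φ Γ}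
  disjoint : Disjoint (positivePart Φ Γ) {v | -v ∈ positivePart Φ Γ}

/-- A root subsystem of `Φ` is a subset of `Φ` which is itself a root system. -/
def IsRootSubsystem (Φ Λ : Set E) : Prop :=
  Λ ⊆ Φ ∧ IsRootSystem B Λ

/-- A simple subsystem of `Φ` is a simple system of some root subsystem of `Φ`. -/
def IsSimpleSubsystem (Φ Γ : Set E) : Prop :=
  ∃ Λ : Set E, IsRootSubsystem B Φ Λ ∧ IsSimpleSystem Λ Γ

/-- The closed fundamental chamber of the reflection group with simple roots `Γ`. -/
def chamber (Γ : Set E) : Set E :=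
  {v | ∀ γ ∈ Γ, 0 ≤ B v γ}

/-- The group generated by the reflections in the elements of `Φ`. -/
def weylGroup (Φ : Set E) : Subgroup (E ≃ₗ[ℝ] E) :=
  Subgroup.closure {g | ∃ α ∈ Φ, (g : E →ₗ[ℝ] E) = reflection B α}

/-- The entry of the Coxeter matrix at `α, β`: the order of the product of the reflections in
`α` and `β` (with the value `0` for infinite order). -/
def coxeterEntry (α β : E) : ℕ :=
  orderOf (reflection B α * reflection B β)

/-- The underlying simple graph of the Coxeter graph of `Γ`; its edge labels are the
values of `coxeterEntry B`. -/
def coxeterGraph (Γ : Set E) : SimpleGraph Γ :=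
  SimpleGraph.fromRel fun α β : Γ => coxeterEntry B (α : E) (β : E) ≠ 2

/-- `C` is the set of vertices of a connected component of the Coxeter graph of `Γ`. -/
def IsComponent (Γ C : Set E) : Prop :=
  ∃ c : (coxeterGraph B Γ).ConnectedComponent, C = Subtype.val '' c.supp

/-- The Coxeter graph of `C` has the type given by the Coxeter matrix `M`. -/
def HasType {ι : Type*} (C : Set E) (M : CoxeterMatrix ι) : Prop :=
  ∃ e : ι ≃ C, ∀ i j : ι, coxeterEntry B (e i : E) (e j : E) = M i j

/-- All edges of the Coxeter graph of `C` are simple, i.e. have label `3`. -/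
def IsSimplyLaced (C : Set E) : Prop :=
  ∀ α ∈ C, ∀ β ∈ C, α ≠ β → coxeterEntry B α β = 2 ∨ coxeterEntry B α β = 3

/-- The Coxeter graphs of `C` and `C'` are isomorphic (as graphs with labelled edges). -/
def SameType {E' : Type*} [AddCommGroup E'] [Module ℝ E'] (B' : LinearMap.BilinForm ℝ E')
    (C : Set E) (C' : Set E') : Prop :=
  ∃ e : C ≃ C', ∀ α β : C,
    coxeterEntry B' (e α : E') (e β : E') = coxeterEntry B (α : E) (β : E)

end RootSystems

/-- The Coxeter matrix of type `D₆`: the path `0 - 1 - 2 - 3 - 4` together with the edge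
`3 - 5`. -/
def coxeterD6 : CoxeterMatrix (Fin 6) where
  M := !![1, 3, 2, 2, 2, 2;
          3, 1, 3, 2, 2, 2;
          2, 3, 1, 3, 2, 2;
          2, 2, 3, 1, 3, 3;
          2, 2, 2, 3, 1, 2;
          2, 2, 2, 3, 2, 1]
  off_diagonal i j hij := by
    fin_cases i <;> fin_cases j <;> first | exact absurd rfl hij | simp

/-! ### The ring `ℤ[τ]` -/

/-- The ring `R = ℤ[τ]`, where `τ` is the golden ratio. -/
abbrev goldenRing : Subalgebra ℤ ℝ := Algebra.adjoin ℤ {φ}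

/-- The golden ratio as an element of `ℤ[τ]`. -/
def tau : goldenRing := ⟨φ, Algebra.subset_adjoin rfl⟩

theorem mem_goldenRing_iff {x : ℝ} : x ∈ goldenRing ↔ ∃ a b : ℤ, x = a + b * φ := by
  constructor
  · intro hx
    induction hx using Algebra.adjoin_induction with
    | mem x hx => exact ⟨0, 1, by simpa using hx⟩
    | algebraMap r => exact ⟨r, 0, by simp⟩
    | add x y _ _ hx hy =>
      obtain ⟨a, b, rfl⟩ := hx
      obtain ⟨c, d, rfl⟩ := hy
      exact ⟨a + c, b + d, by push_cast; ring⟩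
    | mul x y _ _ hx hy =>
      obtain ⟨a, b, rfl⟩ := hx
      obtain ⟨c, d, rfl⟩ := hy
      refine ⟨a * c + b * d, a * d + b * c + b * d, ?_⟩
      push_cast
      linear_combination (b * d : ℝ) * Real.goldenRatio_sq
  · rintro ⟨a, b, rfl⟩
    exact add_mem (intCast_mem _ a) (mul_mem (intCast_mem _ b) tau.2)

theorem golden_coeff_unique {a b c d : ℤ} (h : (a : ℝ) + b * φ = c + d * φ) :
    a = c ∧ b = d := by
  have hbd : b = d := by
    by_contra hne
    have hne' : ((b - d : ℤ) : ℚ) ≠ 0 := by exact_mod_cast sub_ne_zero.mpr hne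
    refine Real.goldenRatio_irrational ⟨((c - a : ℤ) : ℚ) / ((b - d : ℤ) : ℚ), ?_⟩
    have hne'' : ((b : ℝ) - d) ≠ 0 := by exact_mod_cast sub_ne_zero.mpr hne
    push_cast
    rw [div_eq_iff hne'']
    linear_combination -h
  subst hbd
  exact ⟨by exact_mod_cast add_right_cancel h, rfl⟩

/-- The `ℤ`-linear map `θ : ℤ[τ] → ℤ`, `θ(a + bτ) = a`. -/
def theta : goldenRing →ₗ[ℤ] ℤ :=
  AddMonoidHom.toIntLinearMap
    { toFun := fun x => (mem_goldenRing_iff.1 x.2).choose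
      map_zero' := by
        obtain ⟨b, hb⟩ := (mem_goldenRing_iff.1 (0 : goldenRing).2).choose_spec
        have h : (((mem_goldenRing_iff.1 (0 : goldenRing).2).choose : ℤ) : ℝ) + b * φ
            = ((0 : ℤ) : ℝ) + ((0 : ℤ) : ℝ) * φ := by
          rw [← hb]; simp
        exact (golden_coeff_unique h).1
      map_add' := by
        intro x y
        obtain ⟨b, hb⟩ := (mem_goldenRing_iff.1 x.2).choose_spec
        obtain ⟨d, hd⟩ := (mem_goldenRing_iff.1 y.2).choose_spec
        obtain ⟨f, hf⟩ := (mem_goldenRing_iff.1 (x + y).2).choose_spec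
        have h : (((mem_goldenRing_iff.1 (x + y).2).choose : ℤ) : ℝ) + f * φ
            = (((mem_goldenRing_iff.1 x.2).choose + (mem_goldenRing_iff.1 y.2).choose : ℤ) : ℝ)
              + ((b + d : ℤ) : ℝ) * φ := by
          rw [← hf]
          push_cast
          linear_combination hb + hd
        exact (golden_coeff_unique h).1 }

theorem theta_apply {x : goldenRing} {a b : ℤ} (h : (x : ℝ) = a + b * φ) : theta x = a := by
  obtain ⟨c, hc⟩ := (mem_goldenRing_iff.1 x.2).choose_spec
  have h' : (((mem_goldenRing_iff.1 x.2).choose : ℤ) : ℝ) + c * φ = a + b * φ := by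
    rw [← hc, h]
  exact (golden_coeff_unique h').1

/-! ### The root lattice and the simply laced root system -/

section Lattice

variable {V : Type*} [NormedAddCommGroup V] [InnerProductSpace ℝ V]

/-- `Φ` is a root system in the Euclidean space `V` and `P` is a simple system of `Φ`, normalised
so that `⟨α, α⟩ = 2` and `⟨α, β⟩ ∈ {0, -1, -τ}` for all distinct `α, β ∈ P`. -/
structure IsGoldenRootSystem (Φ P : Set V) : Prop where
  isRootSystem : IsRootSystem (innerₗ V) Φ
  isSimpleSystem : IsSimpleSystem Φ P
  inner_self : ∀ α ∈ P, inner ℝ α α = 2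
  inner_of_ne : ∀ α ∈ P, ∀ β ∈ P, α ≠ β →
    inner ℝ α β = 0 ∨ inner ℝ α β = -1 ∨ inner ℝ α β = -φ

/-- The `ℤ[τ]`-submodule `U` of `V` spanned by `P`. -/
abbrev rootLattice (P : Set V) : Submodule goldenRing V := Submodule.span goldenRing P

/-- The real vector space `ℝ ⊗ U`. -/
abbrev RealLattice (P : Set V) : Type _ := ℝ ⊗[ℤ] rootLattice P

/-- The image of `A ∩ U` under the natural embedding `U → ℝ ⊗ U`. -/
def embed (P A : Set V) : Set (RealLattice P) :=
  (fun u : rootLattice P => (1 : ℝ) ⊗ₜ[ℤ] u) '' {u | (u : V) ∈ A}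

/-- The map `Γ ↦ Γ ∪ τΓ`, with values regarded as subsets of `ℝ ⊗ U`. -/
def doubling (P Γ : Set V) : Set (RealLattice P) :=
  embed P Γ ∪ embed P ((fun v : V => φ • v) '' Γ)

/-- The bundle `{α, τα}`, regarded as a subset of `ℝ ⊗ U`. -/
def bundle (P : Set V) (α : V) : Set (RealLattice P) := embed P {α, φ • α}

/-- `A` is a union of bundles `{α, τα}` with `α ∈ Φ`. -/
def IsUnionOfBundles (Φ P : Set V) (A : Set (RealLattice P)) : Prop :=
  ∃ I : Set V, I ⊆ Φ ∧ A = ⋃ α ∈ I, bundle P α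

namespace IsGoldenRootSystem

variable {Φ P : Set V}

theorem inner_mem_of_mem (h : IsGoldenRootSystem Φ P) {α β : V} (hα : α ∈ P) (hβ : β ∈ P) :
    inner ℝ α β ∈ goldenRing := by
  by_cases hab : α = β
  · subst hab
    rw [h.inner_self α hα]
    exact mem_goldenRing_iff.2 ⟨2, 0, by simp⟩
  · rcases h.inner_of_ne α hα β hβ hab with h' | h' | h' <;> rw [h']
    · exact zero_mem _
    · exact neg_mem (one_mem _)
    · exact neg_mem tau.2

/-- The inner product takes values in `ℤ[τ]` on `U`. -/
theorem inner_mem (h : IsGoldenRootSystem Φ P) {u v : V} (hu : u ∈ rootLattice P)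
    (hv : v ∈ rootLattice P) : inner ℝ u v ∈ goldenRing := by
  induction hu, hv using Submodule.span_induction₂ with
  | mem_mem x y hx hy => exact h.inner_mem_of_mem hx hy
  | zero_left y hy => simp
  | zero_right x hx => simp
  | add_left x y z _ _ _ h₁ h₂ => rw [inner_add_left]; exact add_mem h₁ h₂
  | add_right x y z _ _ _ h₁ h₂ => rw [inner_add_right]; exact add_mem h₁ h₂
  | smul_left r x y _ _ h₁ =>
    have hr : r • x = (r : ℝ) • x := rfl
    rw [hr, real_inner_smul_left]; exact mul_mem r.2 h₁
  | smul_right r x y _ _ h₁ =>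
    have hr : r • y = (r : ℝ) • y := rfl
    rw [hr, real_inner_smul_right]; exact mul_mem r.2 h₁

/-- The `ℤ`-bilinear form `(u, v) = θ(⟨u, v⟩)` on `U`. -/
def latticeForm (h : IsGoldenRootSystem Φ P) : LinearMap.BilinForm ℤ (rootLattice P) :=
  LinearMap.mk₂ ℤ (fun u v => theta ⟨inner ℝ (u : V) (v : V), h.inner_mem u.2 v.2⟩)
    (fun u v w => by
      rw [← map_add]; congr 1; ext; simp [inner_add_left])
    (fun c u v => by
      rw [← map_smul]; congr 1; ext; simp [← Int.cast_smul_eq_zsmul ℝ, real_inner_smul_left])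
    (fun u v w => by
      rw [← map_add]; congr 1; ext; simp [inner_add_right])
    (fun c u v => by
      rw [← map_smul]; congr 1; ext; simp [← Int.cast_smul_eq_zsmul ℝ, real_inner_smul_right])

/-- The real bilinear form on `ℝ ⊗ U` extending `(-, -)`. -/
def realForm (h : IsGoldenRootSystem Φ P) : LinearMap.BilinForm ℝ (RealLattice P) :=
  LinearMap.BilinForm.baseChange ℝ h.latticeForm

theorem realForm_tmul (h : IsGoldenRootSystem Φ P) (u v : rootLattice P) :
    h.realForm (1 ⊗ₜ u) (1 ⊗ₜ v)
      = ((theta ⟨inner ℝ (u : V) (v : V), h.inner_mem u.2 v.2⟩ : ℤ) : ℝ) := by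
  simp [realForm, latticeForm]

theorem exists_functional (h : IsGoldenRootSystem Φ P) (g : P → ℝ) :
    ∃ f : V →ₗ[ℝ] ℝ, ∀ γ : P, f γ = g γ := by
  have hli : LinearIndependent ℝ (fun x : P => (x : V)) := h.isSimpleSystem.linearIndepOn
  obtain ⟨f, hf⟩ := LinearMap.exists_extend ((Module.Basis.span hli).constr ℝ g)
  refine ⟨f, fun γ => ?_⟩
  have h1 := LinearMap.congr_fun hf (Module.Basis.span hli γ)
  rw [Module.Basis.constr_basis] at h1
  rw [← h1]
  simp [Module.Basis.span_apply]

/-- All roots lie in `U`. -/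
theorem root_mem_rootLattice (h : IsGoldenRootSystem Φ P) {α : V} (hα : α ∈ Φ) :
    α ∈ rootLattice P := by
  classical
  have hPU : ∀ γ ∈ P, γ ∈ rootLattice P := fun γ hγ => Submodule.subset_span hγ
  have hnegpos : ∀ β ∈ Φ, β ∈ Submodule.span ℝ≥0 P ∨ -β ∈ Submodule.span ℝ≥0 P := by
    intro β hβ
    rw [h.isSimpleSystem.eq_union] at hβ
    exact hβ.imp (fun h' => h'.2) (fun h' => h'.2)
  -- it suffices to treat positive roots
  suffices key : ∀ β ∈ positivePart Φ P, β ∈ rootLattice P by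
    rw [h.isSimpleSystem.eq_union] at hα
    rcases hα with hα | hα
    · exact key α hα
    · exact neg_mem_iff.1 (key _ hα)
  by_contra! hbad
  obtain ⟨f, hf⟩ := h.exists_functional (fun _ => 1)
  have hfin : {β | β ∈ positivePart Φ P ∧ β ∉ rootLattice P}.Finite :=
    h.isRootSystem.finite.subset fun β hβ => hβ.1.1
  obtain ⟨β, ⟨⟨hβΦ, hβP⟩, hβU⟩, hmin⟩ := Set.exists_min_image _ f hfin hbad
  have hβ0 : β ≠ 0 := fun h0 => h.isRootSystem.zero_notMem (h0 ▸ hβΦ)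
  obtain ⟨γ, hγ, hpos⟩ : ∃ γ ∈ P, 0 < inner ℝ β γ := by
    by_contra! hle
    have hcone : ∀ v ∈ Submodule.span ℝ≥0 P, inner ℝ β v ≤ 0 := by
      intro v hv
      induction hv using Submodule.span_induction with
      | mem x hx => exact hle x hx
      | zero => simp
      | add x y _ _ hx hy => rw [inner_add_right]; exact add_nonpos hx hy
      | smul c x _ hx =>
        have hc : c • x = (c : ℝ) • x := rfl
        rw [hc, real_inner_smul_right]
        exact mul_nonpos_of_nonneg_of_nonpos c.2 hx
    exact absurd (hcone β hβP) (not_le.2 (real_inner_self_pos.2 hβ0))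
  set t : ℝ := inner ℝ β γ with ht
  have hγγ : inner ℝ γ γ = (2 : ℝ) := h.inner_self γ hγ
  have hs : β - t • γ ∈ Φ := by
    have h1 := h.isRootSystem.reflection_mem γ (h.isSimpleSystem.subset hγ) β hβΦ
    rw [reflection_apply] at h1
    rw [innerₗ_apply_apply, innerₗ_apply_apply, hγγ, div_self two_ne_zero, one_mul] at h1
    exact h1
  rcases hnegpos _ hs with hp | hn
  · have hU : β - t • γ ∈ rootLattice P := by
      by_contra hnU
      have h1 := hmin _ ⟨⟨hs, hp⟩, hnU⟩
      have h2 : f γ = 1 := hf ⟨γ, hγ⟩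
      rw [map_sub, map_smul, h2, smul_eq_mul] at h1
      linarith
    have h3 : t ∈ goldenRing := by
      have h4 := h.inner_mem hU (hPU γ hγ)
      rw [inner_sub_left, real_inner_smul_left, hγγ, ← ht] at h4
      have h5 := neg_mem h4
      ring_nf at h5
      exact h5
    have h6 : (⟨t, h3⟩ : goldenRing) • γ ∈ rootLattice P := Submodule.smul_mem _ _ (hPU γ hγ)
    have h7 : β = (β - t • γ) + (⟨t, h3⟩ : goldenRing) • γ := (sub_add_cancel β (t • γ)).symm
    exact hβU (h7 ▸ add_mem hU h6)
  · obtain ⟨g, hg⟩ := h.exists_functional (fun δ => if (δ : V) = γ then 0 else 1)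
    have hcone : ∀ v ∈ Submodule.span ℝ≥0 P, 0 ≤ g v ∧ (g v = 0 → ∃ c : ℝ, v = c • γ) := by
      intro v hv
      induction hv using Submodule.span_induction with
      | mem x hx =>
        have h1 := hg ⟨x, hx⟩
        by_cases hxγ : x = γ
        · simp only [hxγ, if_true] at h1
          refine ⟨by rw [hxγ, h1], fun _ => ⟨1, by simp [hxγ]⟩⟩
        · simp only [hxγ, if_false] at h1
          exact ⟨by rw [h1]; norm_num, fun h0 => by rw [h1] at h0; norm_num at h0⟩
      | zero => exact ⟨by simp, fun _ => ⟨0, by simp⟩⟩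
      | add x y _ _ hx hy =>
        rw [map_add]
        refine ⟨add_nonneg hx.1 hy.1, fun h0 => ?_⟩
        obtain ⟨a, ha⟩ := hx.2 (by linarith [hx.1, hy.1])
        obtain ⟨b, hb⟩ := hy.2 (by linarith [hx.1, hy.1])
        exact ⟨a + b, by rw [ha, hb, add_smul]⟩
      | smul c x _ hx =>
        have hc : c • x = (c : ℝ) • x := rfl
        rw [hc, map_smul, smul_eq_mul]
        refine ⟨mul_nonneg c.2 hx.1, fun h0 => ?_⟩
        rcases mul_eq_zero.1 h0 with h0 | h0
        · exact ⟨0, by rw [h0, zero_smul, zero_smul]⟩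
        · obtain ⟨a, ha⟩ := hx.2 h0
          exact ⟨c * a, by rw [ha, smul_smul]⟩
    have hgγ : g γ = 0 := by simpa using hg ⟨γ, hγ⟩
    have h1 := (hcone β hβP).1
    have h2 := (hcone _ hn).1
    rw [map_neg, map_sub, map_smul, hgγ, smul_zero, sub_zero] at h2
    obtain ⟨c, hc⟩ := (hcone β hβP).2 (by linarith)
    rcases h.isRootSystem.reduced γ (h.isSimpleSystem.subset hγ) c (hc ▸ hβΦ) with h3 | h3
    · exact hβU (by rw [hc, h3, one_smul]; exact hPU γ hγ)
    · exact hβU (by rw [hc, h3, neg_smul, one_smul]; exact neg_mem (hPU γ hγ))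

/-- The Weyl group preserves the set of roots. -/
theorem weylGroup_apply_mem_root (h : IsGoldenRootSystem Φ P) {w : V ≃ₗ[ℝ] V}
    (hw : w ∈ weylGroup (innerₗ V) Φ) : ∀ β ∈ Φ, w β ∈ Φ := by
  induction hw using Subgroup.closure_induction with
  | mem g hg =>
    obtain ⟨α, hα, hgα⟩ := hg
    intro β hβ
    have h1 : g β = reflection (innerₗ V) α β := LinearMap.congr_fun hgα β
    rw [h1]
    exact h.isRootSystem.reflection_mem α hα β hβ
  | one => exact fun β hβ => hβ
  | mul g k _ _ hg hk => exact fun β hβ => hg _ (hk β hβ)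
  | inv g _ hg =>
    intro β hβ
    obtain ⟨δ, hδ, hδβ⟩ := ((h.isRootSystem.finite.injOn_iff_bijOn_of_mapsTo hg).1
      g.injective.injOn).surjOn hβ
    rw [← hδβ]
    have h1 : g⁻¹ (g δ) = δ := g.symm_apply_apply δ
    rw [h1]
    exact hδ

/-- The Weyl group preserves `U`. -/
theorem weylGroup_apply_mem (h : IsGoldenRootSystem Φ P) {w : V ≃ₗ[ℝ] V}
    (hw : w ∈ weylGroup (innerₗ V) Φ) {u : V} (hu : u ∈ rootLattice P) :
    w u ∈ rootLattice P := by
  induction hu using Submodule.span_induction with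
  | mem x hx =>
    exact h.root_mem_rootLattice
      (h.weylGroup_apply_mem_root hw x (h.isSimpleSystem.subset hx))
  | zero => simp
  | add x y _ _ hx hy => rw [map_add]; exact add_mem hx hy
  | smul r x _ hx =>
    have hr : r • x = (r : ℝ) • x := rfl
    rw [hr, map_smul]
    exact Submodule.smul_mem _ r hx

/-- The restriction of an element of the Weyl group to `U`. -/
def restrictLattice (h : IsGoldenRootSystem Φ P) (w : weylGroup (innerₗ V) Φ) :
    rootLattice P →ₗ[ℤ] rootLattice P :=
  AddMonoidHom.toIntLinearMap
    { toFun := fun u => ⟨(w : V ≃ₗ[ℝ] V) u, h.weylGroup_apply_mem w.2 u.2⟩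
      map_zero' := by ext; simp
      map_add' := fun u v => by ext; simp }

/-- The action of the Weyl group of `Φ` on `ℝ ⊗ U` extending its action on `U`. -/
def act (h : IsGoldenRootSystem Φ P) (w : weylGroup (innerₗ V) Φ) :
    Module.End ℝ (RealLattice P) :=
  (h.restrictLattice w).baseChange ℝ

end IsGoldenRootSystem

end Lattice

end GoldenFolding

end

open GoldenFolding

/-! For x = a + bτ put x̄ = a + b(1 - τ). Then (2τ - 1)θ(x) = (τ - 1)x + τx̄, so the form on ℝ ⊗ U
is a positive combination of the form of V and its Galois conjugate. The conjugate Gram matrix of Π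
has diagonal entries 2 and off-diagonal entries 0, -1 or τ - 1, which are bounded in absolute value
by the original entries 0, -1, -τ. Replacing coordinates by their absolute values therefore bounds
the conjugate form from below by the form of V. This gives positive definiteness without any
classification (`realForm_sum_pos`).

If ⟨α, β⟩ = a + bτ, then (α, β) = a, (α, τβ) = (τα, β) = b and (τα, τβ) = a + b. All roots have norm
2, hence α and τα both have norm 2 for the new form, and the Cauchy–Schwarz inequality leaves only
the values ±2, 0, ±1, ±τ, ±(τ - 1) for ⟨α, β⟩ (`inner_root_cases`). Three facts are finite checks on
this list: Ψ is stable under its reflections (`reflection_mem_doubling`), root subsystems with a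
simple system inherit the hypotheses on Φ (`subsystem`), and the chambers correspond
(`mem_chamber_iff`). That Γ ∪ τΓ is simple follows by induction on the height of a root
(`incl_mem_cone_of_mem_positivePart`).

In the other direction α and τα are orthogonal, and the product of their reflections restricts on U
to the reflection in α (`reflection_reflection_incl`). So stability under reflections passes from Λ
∪ τΛ to Λ. For a simple subsystem I ∪ τI, the required root system is the reflection closure of I,
and the projection ℝ ⊗ U → V carries the cone of I ∪ τI to that of I
(`isSimpleSubsystem_of_doubling`).

In the Coxeter graph an edge labelled 3 becomes two disjoint edges, one in each copy, while an edge
α, β labelled 5 unfolds into the path α - τβ - τα - β (`entry_doubling`). Vectors of negative norm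
exclude every component with a label 5 other than I₂(5), H₃ and H₄ (`component_type`). -/

noncomputable section

namespace GoldenFolding

/-! ### Reflections, cones, positive roots and Coxeter graphs for a Euclidean form. -/

section General

variable {E : Type*} [AddCommGroup E] [Module ℝ E] {B : LinearMap.BilinForm ℝ E}

/-- A symmetric positive definite bilinear form. -/
structure IsEuclidean (B : LinearMap.BilinForm ℝ E) : Prop where
  symm : ∀ x y, B x y = B y x
  pos : ∀ x, x ≠ 0 → 0 < B x x

theorem IsEuclidean.nonneg (hB : IsEuclidean B) (x : E) : 0 ≤ B x x := by
  by_cases hx : x = 0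
  · simp [hx]
  · exact (hB.pos x hx).le

theorem IsEuclidean.eq_zero (hB : IsEuclidean B) {x : E} (hx : B x x ≤ 0) : x = 0 := by
  by_contra h
  exact absurd (hB.pos x h) (not_lt.2 hx)

theorem isEuclidean_innerₗ (V : Type*) [NormedAddCommGroup V] [InnerProductSpace ℝ V] :
    IsEuclidean (innerₗ V) where
  symm _ _ := real_inner_comm _ _
  pos _ hx := real_inner_self_pos.2 hx

theorem IsEuclidean.reflection_reflection (hB : IsEuclidean B) {α : E} (hα : α ≠ 0) (v : E) :
    reflection B α (reflection B α v) = v := by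
  have h := (hB.pos α hα).ne'
  rw [reflection_apply, reflection_apply]
  simp only [map_sub, map_smul, LinearMap.sub_apply, LinearMap.smul_apply, smul_eq_mul]
  match_scalars
  · ring
  · field_simp; ring

theorem IsEuclidean.reflection_self (hB : IsEuclidean B) {α : E} (hα : α ≠ 0) :
    reflection B α α = -α := by
  have h := (hB.pos α hα).ne'
  rw [reflection_apply, div_mul_cancel₀ _ h]
  module

theorem IsEuclidean.form_reflection (hB : IsEuclidean B) {α : E} (hα : α ≠ 0) (v w : E) :
    B (reflection B α v) (reflection B α w) = B v w := by
  have h := (hB.pos α hα).ne'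
  rw [reflection_apply, reflection_apply]
  simp only [map_sub, map_smul, LinearMap.sub_apply, LinearMap.smul_apply, smul_eq_mul,
    hB.symm α w]
  field_simp
  ring

theorem reflection_apply_of_form_eq_two {α : E} (h : B α α = 2) (v : E) :
    reflection B α v = v - B v α • α := by
  rw [reflection_apply, h, div_self two_ne_zero, one_mul]

namespace IsRootSystem

variable {Λ : Set E}

theorem ne_zero (hΛ : IsRootSystem B Λ) {α : E} (hα : α ∈ Λ) : α ≠ 0 :=
  fun h => hΛ.zero_notMem (h ▸ hα)

theorem neg_mem (hΛ : IsRootSystem B Λ) (hB : IsEuclidean B) {α : E} (hα : α ∈ Λ) : -α ∈ Λ := by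
  have h := hΛ.reflection_mem α hα α hα
  rwa [hB.reflection_self (hΛ.ne_zero hα)] at h

end IsRootSystem

/-! ### Cones -/

theorem nnreal_smul_mem_cone {Γ : Set E} {v : E} (hv : v ∈ Submodule.span ℝ≥0 Γ) {c : ℝ}
    (hc : 0 ≤ c) : c • v ∈ Submodule.span ℝ≥0 Γ :=
  Submodule.smul_mem _ (⟨c, hc⟩ : ℝ≥0) hv

theorem map_nonneg_of_mem_cone {Γ : Set E} (f : E →ₗ[ℝ] ℝ) (hf : ∀ γ ∈ Γ, 0 ≤ f γ) {v : E}
    (hv : v ∈ Submodule.span ℝ≥0 Γ) : 0 ≤ f v := by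
  induction hv using Submodule.span_induction with
  | mem x hx => exact hf x hx
  | zero => simp
  | add x y _ _ hx hy => rw [map_add]; exact add_nonneg hx hy
  | smul c x _ hx =>
    have hc : c • x = (c : ℝ) • x := rfl
    rw [hc, map_smul, smul_eq_mul]
    exact mul_nonneg c.2 hx

theorem map_mem_cone {E' : Type*} [AddCommGroup E'] [Module ℝ E'] {Γ : Set E} {Γ' : Set E'}
    (f : E →ₗ[ℝ] E') (hf : ∀ γ ∈ Γ, f γ ∈ Submodule.span ℝ≥0 Γ') {v : E}
    (hv : v ∈ Submodule.span ℝ≥0 Γ) : f v ∈ Submodule.span ℝ≥0 Γ' := by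
  induction hv using Submodule.span_induction with
  | mem x hx => exact hf x hx
  | zero => simp
  | add x y _ _ hx hy => rw [map_add]; exact add_mem hx hy
  | smul c x _ hx =>
    have hc : c • x = (c : ℝ) • x := rfl
    rw [hc, map_smul]
    exact nnreal_smul_mem_cone hx c.2

theorem exists_functional {Γ : Set E} (hli : LinearIndepOn ℝ id Γ) (g : E → ℝ) :
    ∃ f : E →ₗ[ℝ] ℝ, ∀ γ ∈ Γ, f γ = g γ := by
  have hli : LinearIndependent ℝ (fun x : Γ => (x : E)) := hli
  obtain ⟨f, hf⟩ := LinearMap.exists_extend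
    ((Module.Basis.span hli).constr ℝ fun γ : Γ => g γ)
  refine ⟨f, fun γ hγ => ?_⟩
  have h1 := LinearMap.congr_fun hf (Module.Basis.span hli ⟨γ, hγ⟩)
  rw [Module.Basis.constr_basis] at h1
  rw [← h1]
  simp [Module.Basis.span_apply]

/-- A functional vanishing at `γ`, with value `1` at the other members of `Γ`, vanishes in the
cone of `Γ` only at multiples of `γ`. -/
theorem exists_eq_smul_of_mem_cone {Γ : Set E} {γ : E} (f : E →ₗ[ℝ] ℝ)
    (hf : ∀ δ ∈ Γ, δ ≠ γ → f δ = 1) (hγ : f γ = 0) {v : E}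
    (hv : v ∈ Submodule.span ℝ≥0 Γ) : 0 ≤ f v ∧ (f v = 0 → ∃ c : ℝ, 0 ≤ c ∧ v = c • γ) := by
  induction hv using Submodule.span_induction with
  | mem x hx =>
    by_cases hxγ : x = γ
    · exact ⟨by rw [hxγ, hγ], fun _ => ⟨1, zero_le_one, by simp [hxγ]⟩⟩
    · rw [hf x hx hxγ]
      exact ⟨zero_le_one, fun h0 => absurd h0 one_ne_zero⟩
  | zero => exact ⟨by simp, fun _ => ⟨0, le_rfl, by simp⟩⟩
  | add x y _ _ hx hy =>
    rw [map_add]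
    refine ⟨add_nonneg hx.1 hy.1, fun h0 => ?_⟩
    obtain ⟨a, ha0, ha⟩ := hx.2 (by linarith [hx.1, hy.1])
    obtain ⟨b, hb0, hb⟩ := hy.2 (by linarith [hx.1, hy.1])
    exact ⟨a + b, add_nonneg ha0 hb0, by rw [ha, hb, add_smul]⟩
  | smul c x _ hx =>
    have hc : c • x = (c : ℝ) • x := rfl
    rw [hc, map_smul, smul_eq_mul]
    refine ⟨mul_nonneg c.2 hx.1, fun h0 => ?_⟩
    rcases mul_eq_zero.1 h0 with h0 | h0
    · exact ⟨0, le_rfl, by rw [h0, zero_smul, zero_smul]⟩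
    · obtain ⟨a, ha0, ha⟩ := hx.2 h0
      exact ⟨c * a, mul_nonneg c.2 ha0, by rw [ha, smul_smul]⟩

theorem eq_zero_of_mem_cone_of_neg_mem_cone {Γ : Set E} (hli : LinearIndepOn ℝ id Γ) {v : E}
    (hv : v ∈ Submodule.span ℝ≥0 Γ) (hv' : -v ∈ Submodule.span ℝ≥0 Γ) : v = 0 := by
  classical
  obtain ⟨f, hf⟩ := exists_functional hli fun δ => if δ = 0 then 0 else 1
  have hf' : ∀ δ ∈ Γ, δ ≠ 0 → f δ = 1 := fun δ hδ h0 => by rw [hf δ hδ, if_neg h0]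
  -- With `γ := 0` the functional is 1 on all non-zero members of `Γ`, and "multiple of `γ`" means
  -- zero.
  have h1 := exists_eq_smul_of_mem_cone (γ := 0) f hf' (map_zero f) hv
  have h2 := exists_eq_smul_of_mem_cone (γ := 0) f hf' (map_zero f) hv'
  rw [map_neg] at h2
  obtain ⟨c, -, hc⟩ := h1.2 (by linarith [h1.1, h2.1])
  rw [hc, smul_zero]

theorem IsSimpleSystem.of_forall {Λ Γ : Set E} (hsub : Γ ⊆ Λ) (hli : LinearIndepOn ℝ id Γ)
    (h0 : (0 : E) ∉ Λ) (hneg : ∀ α ∈ Λ, -α ∈ Λ)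
    (hcone : ∀ α ∈ Λ, α ∈ Submodule.span ℝ≥0 Γ ∨ -α ∈ Submodule.span ℝ≥0 Γ) :
    IsSimpleSystem Λ Γ where
  subset := hsub
  linearIndepOn := hli
  eq_union := by
    ext v
    constructor
    · intro hv
      exact (hcone v hv).imp (fun h => ⟨hv, h⟩) (fun h => ⟨hneg v hv, h⟩)
    · rintro (hv | hv)
      · exact hv.1
      · simpa using hneg _ hv.1
  disjoint := by
    rw [Set.disjoint_left]
    intro v hv hv'
    exact h0 (eq_zero_of_mem_cone_of_neg_mem_cone hli hv.2 hv'.2 ▸ hv.1)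

/-! ### Positive roots -/

namespace IsSimpleSystem

variable {Λ Γ : Set E}

theorem mem_cone_or (hΓ : IsSimpleSystem Λ Γ) {α : E} (hα : α ∈ Λ) :
    α ∈ Submodule.span ℝ≥0 Γ ∨ -α ∈ Submodule.span ℝ≥0 Γ := by
  rw [hΓ.eq_union] at hα
  exact hα.imp (fun h => h.2) (fun h => h.2)

theorem smul_sub_smul_notMem (hΓ : IsSimpleSystem Λ Γ) {γ δ : E} (hγ : γ ∈ Γ) (hδ : δ ∈ Γ)
    (hne : γ ≠ δ) {c d : ℝ} (hc : 0 < c) (hd : 0 < d) : c • γ - d • δ ∉ Λ := by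
  classical
  intro hmem
  rcases hΓ.mem_cone_or hmem with h | h
  · obtain ⟨f, hf⟩ := exists_functional hΓ.linearIndepOn fun x => if x = δ then 1 else 0
    have h1 := map_nonneg_of_mem_cone f (fun x hx => by rw [hf x hx]; split_ifs <;> norm_num) h
    rw [map_sub, map_smul, map_smul, hf γ hγ, hf δ hδ, if_pos rfl, if_neg hne] at h1
    simp only [smul_eq_mul, mul_zero, mul_one] at h1
    linarith
  · obtain ⟨f, hf⟩ := exists_functional hΓ.linearIndepOn fun x => if x = γ then 1 else 0
    have h1 := map_nonneg_of_mem_cone f (fun x hx => by rw [hf x hx]; split_ifs <;> norm_num) h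
    rw [map_neg, map_sub, map_smul, map_smul, hf γ hγ, hf δ hδ, if_pos rfl, if_neg hne.symm] at h1
    simp only [smul_eq_mul, mul_zero, mul_one] at h1
    linarith

/-- If B(γ, δ) were positive, reflecting γ in δ would give a root with coefficients of both signs.
-/
theorem form_nonpos (hΓ : IsSimpleSystem Λ Γ) (hB : IsEuclidean B) (hΛ : IsRootSystem B Λ)
    {γ δ : E} (hγ : γ ∈ Γ) (hδ : δ ∈ Γ) (hne : γ ≠ δ) : B γ δ ≤ 0 := by
  by_contra! hpos
  have h1 := hΛ.reflection_mem δ (hΓ.subset hδ) γ (hΓ.subset hγ)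
  rw [reflection_apply] at h1
  refine hΓ.smul_sub_smul_notMem hγ hδ hne one_pos
    (d := 2 / B δ δ * B γ δ) ?_ (by rwa [one_smul])
  have := hB.pos δ (hΛ.ne_zero (hΓ.subset hδ))
  positivity

/-- A positive root other than γ has a positive coefficient at some other simple root. Adding
multiples of γ does not change that coefficient, so the new root cannot be negative. -/
theorem mem_positivePart_of_eq_add (hΓ : IsSimpleSystem Λ Γ) (hΛ : IsRootSystem B Λ)
    {β γ v : E} (hβ : β ∈ positivePart Λ Γ) (hβγ : β ≠ γ) (hγ : γ ∈ Γ) {c d : ℝ} (hc : 0 < c)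
    (hv : v = c • β + d • γ) (hvΛ : v ∈ Λ) : v ∈ positivePart Λ Γ := by
  classical
  refine ⟨hvΛ, (hΓ.mem_cone_or hvΛ).resolve_right fun hneg => ?_⟩
  obtain ⟨f, hf⟩ := exists_functional hΓ.linearIndepOn fun x => if x = γ then 0 else 1
  have hγ0 : f γ = 0 := by rw [hf γ hγ, if_pos rfl]
  have hf' : ∀ δ ∈ Γ, δ ≠ γ → f δ = 1 := fun δ hδ h0 => by rw [hf δ hδ, if_neg h0]
  have h1 := exists_eq_smul_of_mem_cone f hf' hγ0 hβ.2
  have h2 := (exists_eq_smul_of_mem_cone f hf' hγ0 hneg).1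
  rw [hv, map_neg, map_add, map_smul, map_smul, hγ0, smul_zero, add_zero, smul_eq_mul] at h2
  obtain ⟨a, ha0, ha⟩ := h1.2 (by nlinarith [h1.1])
  rcases hΛ.reduced γ (hΓ.subset hγ) a (ha ▸ hβ.1) with h3 | h3
  · exact hβγ (by rw [ha, h3, one_smul])
  · linarith

/-- Otherwise β, being in the cone, would satisfy B(β, β) ≤ 0. Reflecting β in the γ found here
lowers its height, which drives the inductions on positive roots. -/
theorem exists_form_pos (hB : IsEuclidean B) (hΛ : IsRootSystem B Λ)
    {β : E} (hβ : β ∈ positivePart Λ Γ) : ∃ γ ∈ Γ, 0 < B β γ := by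
  by_contra! hle
  have h := map_nonneg_of_mem_cone (-(B β)) (fun γ hγ => by simpa using hle γ hγ) hβ.2
  have h1 := hB.pos β (hΛ.ne_zero hβ.1)
  rw [LinearMap.neg_apply] at h
  linarith

/-- Induction on the height of a positive root. -/
theorem positivePart_induction (hΛ : IsRootSystem B Λ) (f : E →ₗ[ℝ] ℝ) {p : E → Prop}
    (step : ∀ β ∈ positivePart Λ Γ, (∀ δ ∈ positivePart Λ Γ, f δ < f β → p δ) → p β) :
    ∀ β ∈ positivePart Λ Γ, p β := by
  by_contra! hbad
  have hfin : {β | β ∈ positivePart Λ Γ ∧ ¬p β}.Finite := hΛ.finite.subset fun β hβ => hβ.1.1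
  obtain ⟨β, ⟨hβ, hpβ⟩, hmin⟩ := Set.exists_min_image _ f hfin hbad
  refine hpβ (step β hβ fun δ hδ hlt => ?_)
  by_contra hpδ
  exact absurd (hmin δ ⟨hδ, hpδ⟩) (not_le.2 hlt)

end IsSimpleSystem

/-! ### Orders of products of two reflections -/

theorem reflection_mul_reflection_pow_three {α β : E} (hB : IsEuclidean B) (hα : B α α = 2)
    (hβ : B β β = 2) (h : B α β = -1) : (reflection B α * reflection B β) ^ 3 = 1 := by
  have h' : B β α = -1 := by rw [hB.symm, h]
  ext v
  simp only [pow_succ, pow_zero, one_mul, Module.End.mul_apply, Module.End.one_apply,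
    reflection_apply_of_form_eq_two hα, reflection_apply_of_form_eq_two hβ,
    map_sub, map_smul, LinearMap.sub_apply, LinearMap.smul_apply, smul_eq_mul, hα, hβ, h, h']
  match_scalars <;> ring

theorem reflection_mul_reflection_apply {α β : E} (hB : IsEuclidean B) (hα : B α α = 2)
    (hβ : B β β = 2) {t : ℝ} (h : B α β = t) (v : E) (x y : ℝ) :
    (reflection B α * reflection B β) (v + (x • α + y • β)) =
      v + ((-x - B v α + t * (B v β + t * x + y)) • α + (-(B v β) - t * x - y) • β) := by
  have h' : B β α = t := by rw [hB.symm, h]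
  simp only [Module.End.mul_apply,
    reflection_apply_of_form_eq_two hα, reflection_apply_of_form_eq_two hβ, map_add,
    map_sub, map_smul, LinearMap.sub_apply, LinearMap.smul_apply,
    smul_eq_mul, hα, hβ, h, h']
  match_scalars <;> ring

/-- On the plane of α and β the product has determinant 1 and trace t² - 2. The relation t² + t = 1
says that this trace is 2cos of a multiple of 2π/5. -/
theorem reflection_mul_reflection_pow_five {α β : E} (hB : IsEuclidean B) (hα : B α α = 2)
    (hβ : B β β = 2) {t : ℝ} (h : B α β = t) (ht : t ^ 2 + t = 1) :
    (reflection B α * reflection B β) ^ 5 = 1 := by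
  ext v
  have h0 : v = v + ((0 : ℝ) • α + (0 : ℝ) • β) := by simp
  rw [Module.End.one_apply]
  simp only [pow_succ, pow_zero, one_mul]
  rw [Module.End.mul_apply, Module.End.mul_apply, Module.End.mul_apply, Module.End.mul_apply]
  nth_rewrite 1 [h0]
  nth_rewrite 2 [h0]
  simp only [reflection_mul_reflection_apply hB hα hβ h]
  generalize B v α = p
  generalize B v β = q
  congr 3 <;> grind

theorem reflection_mul_reflection_ne_one {α β : E} (hB : IsEuclidean B) (hα : B α α = 2)
    (hβ : B β β = 2) (h : B α β ^ 2 ≠ 4) :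
    reflection B α * reflection B β ≠ 1 := by
  intro h1
  have h2 := LinearMap.congr_fun h1 β
  rw [Module.End.mul_apply, reflection_apply_of_form_eq_two hβ, hβ, Module.End.one_apply,
    reflection_apply_of_form_eq_two hα] at h2
  have h4 := congrArg (B β) h2
  simp only [map_sub, map_smul, LinearMap.sub_apply, LinearMap.smul_apply, smul_eq_mul,
    hβ, hB.symm β α] at h4
  apply h
  linear_combination h4

theorem coxeterEntry_self {α : E} (hB : IsEuclidean B) (hα : α ≠ 0) : coxeterEntry B α α = 1 := by
  rw [coxeterEntry, orderOf_eq_one_iff]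
  ext v
  exact hB.reflection_reflection hα v

theorem coxeterEntry_eq_two {α β : E} (hB : IsEuclidean B) (hα : B α α = 2) (hβ : B β β = 2)
    (h : B α β = 0) : coxeterEntry B α β = 2 := by
  have : Fact (Nat.Prime 2) := ⟨Nat.prime_two⟩
  refine orderOf_eq_prime ?_ (reflection_mul_reflection_ne_one hB hα hβ (by rw [h]; norm_num))
  have h' : B β α = 0 := by rw [hB.symm, h]
  ext v
  simp only [pow_succ, pow_zero, one_mul, Module.End.mul_apply, Module.End.one_apply,
    reflection_apply_of_form_eq_two hα, reflection_apply_of_form_eq_two hβ,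
    map_sub, map_smul, LinearMap.sub_apply, LinearMap.smul_apply, smul_eq_mul, hα, hβ, h, h']
  match_scalars <;> ring

theorem coxeterEntry_eq_three {α β : E} (hB : IsEuclidean B) (hα : B α α = 2) (hβ : B β β = 2)
    (h : B α β = -1) : coxeterEntry B α β = 3 := by
  have : Fact (Nat.Prime 3) := ⟨Nat.prime_three⟩
  exact orderOf_eq_prime (reflection_mul_reflection_pow_three hB hα hβ h)
    (reflection_mul_reflection_ne_one hB hα hβ (by rw [h]; norm_num))

theorem coxeterEntry_eq_five {α β : E} (hB : IsEuclidean B) (hα : B α α = 2) (hβ : B β β = 2)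
    (h : B α β = -φ) : coxeterEntry B α β = 5 := by
  have : Fact (Nat.Prime 5) := ⟨Nat.prime_five⟩
  have hφ := Real.goldenRatio_sq
  refine orderOf_eq_prime (reflection_mul_reflection_pow_five hB hα hβ h ?_)
    (reflection_mul_reflection_ne_one hB hα hβ ?_)
  · linear_combination hφ
  · rw [h, neg_sq, hφ]
    intro h3
    have h4 : φ = 3 := by linarith
    rw [h4] at hφ
    norm_num at hφ

/-! ### Components of the Coxeter graph -/

/-- The subset `T` of `Γ` contains all neighbours of its members in `Γ`. -/
def IsAdjClosed (B : LinearMap.BilinForm ℝ E) (Γ T : Set E) : Prop :=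
  ∀ s ∈ T, ∀ x ∈ Γ, B s x ≠ 0 → x ∈ T

/-- The entries of the Coxeter matrix of `Γ` are `2` exactly for orthogonal vectors. -/
def HasOrthogonalEntries (B : LinearMap.BilinForm ℝ E) (Γ : Set E) : Prop :=
  ∀ α ∈ Γ, ∀ β ∈ Γ, α ≠ β → (coxeterEntry B α β = 2 ↔ B α β = 0)

theorem coxeterGraph_adj_iff (hB : IsEuclidean B) {Γ : Set E} (hΓ : HasOrthogonalEntries B Γ)
    (α β : Γ) : (coxeterGraph B Γ).Adj α β ↔ α ≠ β ∧ B (α : E) β ≠ 0 := by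
  rw [coxeterGraph, SimpleGraph.fromRel_adj]
  refine and_congr_right fun hne => ?_
  have hne' : (α : E) ≠ β := fun h => hne (Subtype.ext h)
  rw [Ne, Ne, hΓ α α.2 β β.2 hne', hΓ β β.2 α α.2 hne'.symm, hB.symm (β : E) α, or_self]

/-- Membership in a neighbour-closed set propagates along walks, so components are the minimal
non-empty neighbour-closed sets. Later arguments on components can then work with inner products
alone. -/
theorem isComponent_iff (hB : IsEuclidean B) {Γ : Set E} (hΓ : HasOrthogonalEntries B Γ)
    (C : Set E) : IsComponent B Γ C ↔ C ⊆ Γ ∧ C.Nonempty ∧ IsAdjClosed B Γ C ∧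
      ∀ T ⊆ C, T.Nonempty → IsAdjClosed B Γ T → T = C := by
  have hreach : ∀ T : Set E, IsAdjClosed B Γ T → ∀ x y : Γ, (coxeterGraph B Γ).Reachable x y →
      (x : E) ∈ T → (y : E) ∈ T := by
    rintro T hT x y ⟨w⟩ hx
    induction w with
    | nil => exact hx
    | cons hadj _ ih =>
      exact ih (hT _ hx _ (Subtype.prop _) ((coxeterGraph_adj_iff hB hΓ _ _).1 hadj).2)
  have hclosed : ∀ c : (coxeterGraph B Γ).ConnectedComponent,
      IsAdjClosed B Γ (Subtype.val '' c.supp) := by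
    rintro c _ ⟨s, hs, rfl⟩ x hx hsx
    refine ⟨⟨x, hx⟩, ?_, rfl⟩
    by_cases hxs : s = ⟨x, hx⟩
    · exact hxs ▸ hs
    · exact SimpleGraph.ConnectedComponent.mem_supp_of_adj_mem_supp c hs
        ((coxeterGraph_adj_iff hB hΓ s ⟨x, hx⟩).2 ⟨hxs, hsx⟩)
  constructor
  · rintro ⟨c, rfl⟩
    refine ⟨?_, c.nonempty_supp.image _, hclosed c, ?_⟩
    · rintro _ ⟨x, -, rfl⟩
      exact x.2
    · rintro T hTC ⟨t, ht⟩ hT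
      refine hTC.antisymm ?_
      rintro _ ⟨x, hx, rfl⟩
      obtain ⟨s, hs, rfl⟩ := hTC ht
      refine hreach T hT s x (SimpleGraph.ConnectedComponent.exact ?_) ht
      rw [SimpleGraph.ConnectedComponent.mem_supp_iff] at hs hx
      rw [hs, hx]
  · rintro ⟨hCΓ, ⟨s, hs⟩, hC, hmin⟩
    refine ⟨(coxeterGraph B Γ).connectedComponentMk ⟨s, hCΓ hs⟩, ?_⟩
    symm
    refine hmin _ ?_ ⟨s, ⟨⟨s, hCΓ hs⟩, rfl, rfl⟩⟩ (hclosed _)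
    rintro _ ⟨x, hx, rfl⟩
    exact hreach C hC ⟨s, hCΓ hs⟩ x (SimpleGraph.ConnectedComponent.exact hx.symm) hs

end General

/-! ### The lattice form on U and its positive definiteness. -/

section GoldenLattice

variable {V : Type*} [NormedAddCommGroup V] [InnerProductSpace ℝ V] {Φ P : Set V}

/-- The natural map `U → ℝ ⊗ U`. -/
def incl (P : Set V) : rootLattice P →+ RealLattice P :=
  (TensorProduct.mk ℤ ℝ (rootLattice P) 1).toAddMonoidHom

theorem incl_apply (u : rootLattice P) : incl P u = (1 : ℝ) ⊗ₜ[ℤ] u := rfl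

/-- Multiplication by `τ` on `U`. -/
def tauEnd (P : Set V) : rootLattice P →+ rootLattice P :=
  DistribSMul.toAddMonoidHom (rootLattice P) tau

theorem coe_tauEnd (u : rootLattice P) : (tauEnd P u : V) = φ • (u : V) := rfl

theorem tauEnd_tauEnd (u : rootLattice P) : tauEnd P (tauEnd P u) = tauEnd P u + u := by
  ext
  rw [Submodule.coe_add, coe_tauEnd, coe_tauEnd, smul_smul, ← pow_two, Real.goldenRatio_sq,
    add_smul, one_smul]

theorem mem_embed {A : Set V} {x : RealLattice P} :
    x ∈ embed P A ↔ ∃ u : rootLattice P, (u : V) ∈ A ∧ incl P u = x := Iff.rfl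

theorem mem_embed_smul {A : Set V} {x : RealLattice P} :
    x ∈ embed P ((fun v : V => φ • v) '' A) ↔
      ∃ u : rootLattice P, (u : V) ∈ A ∧ incl P (tauEnd P u) = x := by
  rw [mem_embed]
  constructor
  · rintro ⟨u, ⟨v, hv, hvu⟩, rfl⟩
    -- τ is a unit with inverse τ - 1, so `φ • v` in U forces `v` in U.
    have h1 : ((tauEnd P u - u : rootLattice P) : V) = v := by
      have h2 : ((tauEnd P u - u : rootLattice P) : V) = (φ - 1) • (u : V) := by
        rw [Submodule.coe_sub, coe_tauEnd, sub_smul, one_smul]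
      rw [h2, ← hvu, smul_smul, show (φ - 1) * φ = 1 by linear_combination Real.goldenRatio_sq,
        one_smul]
    refine ⟨tauEnd P u - u, by rwa [h1], ?_⟩
    congr 1
    ext
    rw [coe_tauEnd, h1]
    exact hvu
  · rintro ⟨u, hu, rfl⟩
    exact ⟨tauEnd P u, ⟨u, hu, rfl⟩, rfl⟩

theorem mem_doubling {A : Set V} {x : RealLattice P} :
    x ∈ doubling P A ↔
      ∃ u : rootLattice P, (u : V) ∈ A ∧ (incl P u = x ∨ incl P (tauEnd P u) = x) := by
  rw [doubling, Set.mem_union, mem_embed, mem_embed_smul, ← exists_or]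
  simp only [and_or_left]

theorem incl_mem_doubling {A : Set V} {u : rootLattice P} (hu : (u : V) ∈ A) :
    incl P u ∈ doubling P A := mem_doubling.2 ⟨u, hu, .inl rfl⟩

theorem incl_tau_mem_doubling {A : Set V} {u : rootLattice P} (hu : (u : V) ∈ A) :
    incl P (tauEnd P u) ∈ doubling P A := mem_doubling.2 ⟨u, hu, .inr rfl⟩

namespace IsGoldenRootSystem

variable (h : IsGoldenRootSystem Φ P)

theorem form_incl_eq_theta (u v : rootLattice P) {x : goldenRing}
    (hx : inner ℝ (u : V) (v : V) = x) : h.realForm (incl P u) (incl P v) = theta x := by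
  rw [incl_apply, incl_apply, h.realForm_tmul]
  congr 2
  exact Subtype.ext hx

theorem exists_inner_eq (h : IsGoldenRootSystem Φ P) (u v : rootLattice P) :
    ∃ a b : ℤ, inner ℝ (u : V) (v : V) = a + b * φ :=
  mem_goldenRing_iff.1 (h.inner_mem u.2 v.2)

theorem form_incl {u v : rootLattice P} {a b : ℤ} (hab : inner ℝ (u : V) (v : V) = a + b * φ) :
    h.realForm (incl P u) (incl P v) = a := by
  rw [h.form_incl_eq_theta u v (x := ⟨_, h.inner_mem u.2 v.2⟩) rfl, theta_apply hab]

/-- τ(a + bτ) = b + (a + b)τ, so pairing with τv reads off the second coefficient. -/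
theorem form_incl_tau {u v : rootLattice P} {a b : ℤ}
    (hab : inner ℝ (u : V) (v : V) = a + b * φ) :
    h.realForm (incl P u) (incl P (tauEnd P v)) = b := by
  refine h.form_incl (a := b) (b := a + b) ?_
  rw [coe_tauEnd, real_inner_smul_right, hab]
  push_cast
  linear_combination (b : ℝ) * Real.goldenRatio_sq

theorem form_tau_incl {u v : rootLattice P} {a b : ℤ}
    (hab : inner ℝ (u : V) (v : V) = a + b * φ) :
    h.realForm (incl P (tauEnd P u)) (incl P v) = b := by
  refine h.form_incl (a := b) (b := a + b) ?_
  rw [coe_tauEnd, real_inner_smul_left, hab]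
  push_cast
  linear_combination (b : ℝ) * Real.goldenRatio_sq

theorem form_tau_tau {u v : rootLattice P} {a b : ℤ}
    (hab : inner ℝ (u : V) (v : V) = a + b * φ) :
    h.realForm (incl P (tauEnd P u)) (incl P (tauEnd P v)) = a + b := by
  have h1 := h.form_incl (u := tauEnd P u) (v := tauEnd P v) (a := a + b) (b := a + 2 * b) (by
    rw [coe_tauEnd, coe_tauEnd, real_inner_smul_left, real_inner_smul_right, hab]
    push_cast
    linear_combination (a + b * φ + b : ℝ) * Real.goldenRatio_sq)
  rw [h1]
  push_cast
  rfl

theorem realForm_symm (x y : RealLattice P) : h.realForm x y = h.realForm y x := by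
  induction x using TensorProduct.induction_on with
  | zero => simp
  | add x₁ x₂ h₁ h₂ => simp [h₁, h₂]
  | tmul r u =>
    induction y using TensorProduct.induction_on with
    | zero => simp
    | add y₁ y₂ h₁ h₂ => simp [h₁, h₂]
    | tmul s v =>
      have hr : r ⊗ₜ[ℤ] u = r • incl P u := by rw [incl_apply, TensorProduct.smul_tmul']; simp
      have hs : s ⊗ₜ[ℤ] v = s • incl P v := by rw [incl_apply, TensorProduct.smul_tmul']; simp
      obtain ⟨a, b, hab⟩ := h.exists_inner_eq u v
      have h1 := h.form_incl hab
      have h2 := h.form_incl ((real_inner_comm _ _).trans hab)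
      rw [hr, hs]
      simp only [map_smul, LinearMap.smul_apply, h1, h2, smul_eq_mul]
      ring

section Gram

variable {κ : Type*} [Fintype κ] (g : κ → rootLattice P)

/-- The quadratic form of `ℝ ⊗ U` as a combination of the quadratic form of `V` and its Galois
conjugate. -/
theorem realForm_sum {A C : κ → κ → ℤ}
    (hAC : ∀ i j, inner ℝ (g i : V) (g j : V) = A i j + C i j * φ) (a b : κ → ℝ) :
    (2 * φ - 1) * h.realForm (∑ i, (a i • incl P (g i) + b i • incl P (tauEnd P (g i))))
        (∑ i, (a i • incl P (g i) + b i • incl P (tauEnd P (g i)))) =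
      (φ - 1) * inner ℝ (∑ i, (a i + b i * φ) • (g i : V)) (∑ i, (a i + b i * φ) • (g i : V)) +
      φ * ∑ i, ∑ j, (a i + b i * (1 - φ)) * (a j + b j * (1 - φ)) *
        (A i j + C i j * (1 - φ)) := by
  simp only [map_sum, LinearMap.sum_apply, sum_inner, inner_sum, real_inner_smul_left,
    real_inner_smul_right, Finset.mul_sum, ← Finset.sum_add_distrib]
  rw [Finset.sum_comm]
  refine Finset.sum_congr rfl fun i _ => Finset.sum_congr rfl fun j _ => ?_
  simp only [map_add, map_smul, LinearMap.add_apply, LinearMap.smul_apply, smul_eq_mul]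
  rw [h.form_incl (hAC i j), h.form_incl_tau (hAC i j), h.form_tau_incl (hAC i j),
    h.form_tau_tau (hAC i j), real_inner_comm, hAC i j]
  -- Each term is the identity (2φ - 1)θ(x) = (φ - 1)x + φx̄ for x = (aᵢ + bᵢτ)(aⱼ + bⱼτ)(A + Cτ),
  -- extended to real aᵢ, bᵢ by bilinearity.
  have := Real.goldenRatio_sq
  generalize (A i j : ℝ) = x
  generalize (C i j : ℝ) = y
  grind

/-- Both summands of `realForm_sum` are non-negative. The first is the norm of a vector of V with
coordinates s, and the second dominates the norm of the vector with coordinates |t|. As (a, b) is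
determined by (s, t), one of the two is strictly positive. -/
theorem realForm_sum_pos (hli : LinearIndependent ℝ fun i => (g i : V))
    (hself : ∀ i, inner ℝ (g i : V) (g i : V) = (2 : ℝ))
    (hne : ∀ i j, i ≠ j → inner ℝ (g i : V) (g j : V) = (0 : ℝ) ∨
      inner ℝ (g i : V) (g j : V) = (-1 : ℝ) ∨ inner ℝ (g i : V) (g j : V) = -φ)
    (a b : κ → ℝ) (hab : a ≠ 0 ∨ b ≠ 0) :
    0 < h.realForm (∑ i, (a i • incl P (g i) + b i • incl P (tauEnd P (g i))))
        (∑ i, (a i • incl P (g i) + b i • incl P (tauEnd P (g i)))) := by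
  choose A C hAC using fun i j => h.exists_inner_eq (g i) (g j)
  have key := h.realForm_sum g hAC a b
  have hφ1 := Real.one_lt_goldenRatio
  have hφ2 := Real.goldenRatio_sq
  set s : κ → ℝ := fun i => a i + b i * φ with hs
  set t : κ → ℝ := fun i => a i + b i * (1 - φ) with ht
  have hpos : ∀ c : κ → ℝ, c ≠ 0 →
      0 < inner ℝ (∑ i, c i • (g i : V)) (∑ i, c i • (g i : V)) := by
    intro c hc
    refine real_inner_self_pos.2 fun h0 => hc ?_
    funext i
    exact Fintype.linearIndependent_iff.1 hli c h0 i
  -- Termwise comparison: the diagonal terms agree, and off the diagonal -|tᵢtⱼ| times 0, 1 or φ is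
  -- at most tᵢtⱼ times 0, -1 or φ - 1, because 0 < φ - 1 < φ.
  have habs : inner ℝ (∑ i, |t i| • (g i : V)) (∑ i, |t i| • (g i : V)) ≤
      ∑ i, ∑ j, t i * t j * (A i j + C i j * (1 - φ)) := by
    simp only [sum_inner, inner_sum, real_inner_smul_left, real_inner_smul_right]
    rw [Finset.sum_comm]
    refine Finset.sum_le_sum fun i _ => Finset.sum_le_sum fun j _ => ?_
    rw [← mul_assoc]
    have hT : |t i| * |t j| = |t i * t j| := (abs_mul _ _).symm
    rw [mul_comm |t j|, hT]
    by_cases hij : i = j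
    · subst hij
      have h1 := golden_coeff_unique (c := 2) (d := 0) ((hAC i i).symm.trans ((hself i).trans (by simp)))
      rw [hself i, h1.1, h1.2, abs_mul_self]
      simp
    · have hle := neg_abs_le (t i * t j)
      have hle' := le_abs_self (t i * t j)
      rcases hne i j hij with h0 | h0 | h0
      · have h1 := golden_coeff_unique (c := 0) (d := 0) ((hAC i j).symm.trans (by simp [h0]))
        rw [h0, h1.1, h1.2]
        simp
      · have h1 := golden_coeff_unique (c := -1) (d := 0) ((hAC i j).symm.trans (by simp [h0]))
        rw [h0, h1.1, h1.2]
        push_cast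
        linarith
      · have h1 := golden_coeff_unique (c := 0) (d := -1) ((hAC i j).symm.trans (by simp [h0]))
        rw [h0, h1.1, h1.2]
        push_cast
        nlinarith [abs_nonneg (t i * t j)]
  have hnn : ∀ v : V, 0 ≤ inner ℝ v v := fun v => real_inner_self_nonneg
  have hst : s ≠ 0 ∨ t ≠ 0 := by
    by_contra! h0
    have hb : b = 0 := by
      funext i
      have h1 := congrFun h0.1 i
      have h2 := congrFun h0.2 i
      simp only [hs, ht, Pi.zero_apply] at h1 h2
      have h3 : (2 * φ - 1) * b i = 0 := by linear_combination h1 - h2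
      exact (mul_eq_zero.1 h3).resolve_left (by linarith)
    have ha : a = 0 := by
      funext i
      have h1 := congrFun h0.1 i
      simp only [hs, hb, Pi.zero_apply, zero_mul, add_zero] at h1
      exact h1
    exact hab.elim (fun h => h ha) (fun h => h hb)
  have hRHS : 0 < (φ - 1) * inner ℝ (∑ i, s i • (g i : V)) (∑ i, s i • (g i : V)) +
      φ * ∑ i, ∑ j, t i * t j * (A i j + C i j * (1 - φ)) := by
    rcases hst with h0 | h0
    · have h1 := hpos s h0
      have h2 := (hnn _).trans habs
      have h3 : 0 < φ - 1 := by linarith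
      have h4 : 0 < φ := by linarith
      positivity
    · have h1 := (hpos (fun i => |t i|) (fun h1 => h0 (funext fun i =>
        abs_eq_zero.1 (congrFun h1 i)))).trans_le habs
      have h2 := hnn (∑ i, s i • (g i : V))
      have h3 : 0 < φ - 1 := by linarith
      have h4 : 0 < φ := by linarith
      positivity
  rw [← key] at hRHS
  exact (mul_pos_iff_of_pos_left (by linarith)).1 hRHS

end Gram

theorem exists_eq_sum [Fintype P] (x : RealLattice P) : ∃ a b : P → ℝ,
    x = ∑ i : P, (a i • incl P ⟨i, Submodule.subset_span i.2⟩ +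
      b i • incl P (tauEnd P ⟨i, Submodule.subset_span i.2⟩)) := by
  classical
  set S : Submodule ℝ (RealLattice P) := Submodule.span ℝ
    (Set.range fun i : P => incl P ⟨i, Submodule.subset_span i.2⟩) ⊔ Submodule.span ℝ
    (Set.range fun i : P => incl P (tauEnd P ⟨i, Submodule.subset_span i.2⟩)) with hS
  -- The images of v and τv are treated together: multiplication by m + nτ mixes the two, since τ² =
  -- τ + 1.
  have hU : ∀ (v : V) (hv : v ∈ rootLattice P), incl P ⟨v, hv⟩ ∈ S ∧ incl P (tauEnd P ⟨v, hv⟩) ∈ S := by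
    intro v hv
    induction hv using Submodule.span_induction with
    | mem v hv =>
      exact ⟨Submodule.mem_sup_left (Submodule.subset_span ⟨⟨v, hv⟩, rfl⟩),
        Submodule.mem_sup_right (Submodule.subset_span ⟨⟨v, hv⟩, rfl⟩)⟩
    | zero =>
      have h0 : (⟨0, zero_mem _⟩ : rootLattice P) = 0 := rfl
      simp only [h0, map_zero]
      exact ⟨zero_mem _, zero_mem _⟩
    | add v w hv hw h₁ h₂ =>
      have h0 : (⟨v + w, add_mem hv hw⟩ : rootLattice P) = ⟨v, hv⟩ + ⟨w, hw⟩ := rfl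
      rw [h0, map_add, map_add, map_add]
      exact ⟨add_mem h₁.1 h₂.1, add_mem h₁.2 h₂.2⟩
    | smul r v hv h₁ =>
      obtain ⟨m, n, hmn⟩ := mem_goldenRing_iff.1 r.2
      have h0 : (⟨r • v, Submodule.smul_mem _ r hv⟩ : rootLattice P) =
          m • ⟨v, hv⟩ + n • tauEnd P ⟨v, hv⟩ := by
        ext
        have h1 : r • v = (r : ℝ) • v := rfl
        simp only [Submodule.coe_add, Submodule.coe_smul_of_tower, h1, hmn, add_smul, mul_smul,
          Int.cast_smul_eq_zsmul]
        rfl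
      have h2 : tauEnd P (⟨r • v, Submodule.smul_mem _ r hv⟩ : rootLattice P) =
          n • ⟨v, hv⟩ + (m + n) • tauEnd P ⟨v, hv⟩ := by
        rw [h0, map_add, map_zsmul, map_zsmul, tauEnd_tauEnd]
        module
      rw [h2, h0]
      simp only [map_add, map_zsmul]
      exact ⟨add_mem (zsmul_mem h₁.1 _) (zsmul_mem h₁.2 _),
        add_mem (zsmul_mem h₁.1 _) (zsmul_mem h₁.2 _)⟩
  have hx : x ∈ S := by
    induction x using TensorProduct.induction_on with
    | zero => exact zero_mem _
    | add x y hx hy => exact add_mem hx hy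
    | tmul r u =>
      have hr : r ⊗ₜ[ℤ] u = r • incl P u := by rw [incl_apply, TensorProduct.smul_tmul']; simp
      rw [hr]
      exact S.smul_mem r (hU u u.2).1
  obtain ⟨y, hy, z, hz, rfl⟩ := Submodule.mem_sup.1 hx
  obtain ⟨a, rfl⟩ := (Submodule.mem_span_range_iff_exists_fun ℝ).1 hy
  obtain ⟨b, rfl⟩ := (Submodule.mem_span_range_iff_exists_fun ℝ).1 hz
  exact ⟨a, b, Finset.sum_add_distrib.symm⟩

theorem finite_simple (h : IsGoldenRootSystem Φ P) : P.Finite := h.isRootSystem.finite.subset h.isSimpleSystem.subset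

theorem isEuclidean : IsEuclidean h.realForm where
  symm := h.realForm_symm
  pos x hx := by
    have := h.finite_simple.fintype
    obtain ⟨a, b, rfl⟩ := exists_eq_sum x
    refine h.realForm_sum_pos (fun i : P => ⟨i, Submodule.subset_span i.2⟩)
      h.isSimpleSystem.linearIndepOn (fun i => h.inner_self i i.2)
      (fun i j hij => h.inner_of_ne i i.2 j j.2 fun h0 => hij (Subtype.ext h0)) a b ?_
    by_contra! h0
    refine hx ?_
    rw [h0.1, h0.2]
    simp

/-- The pairings of u with u and with τu are the two coefficients of ⟨u, u⟩, so if u maps to 0 then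
⟨u, u⟩ = 0. -/
theorem incl_injective (h : IsGoldenRootSystem Φ P) : Function.Injective (incl P) := by
  rw [injective_iff_map_eq_zero]
  intro u hu
  obtain ⟨a, b, hab⟩ := h.exists_inner_eq u u
  have h1 := h.form_incl hab
  have h2 := h.form_incl_tau hab
  simp only [hu, map_zero, LinearMap.zero_apply] at h1 h2
  rw [← h1, ← h2, zero_mul, add_zero] at hab
  exact Subtype.ext (inner_self_eq_zero.1 hab)

end IsGoldenRootSystem

end GoldenLattice

/-! ### The Cauchy–Schwarz inequality for vectors of norm 2, with its equality cases. -/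

section NormTwo

variable {E : Type*} [AddCommGroup E] [Module ℝ E] {B : LinearMap.BilinForm ℝ E}

theorem IsEuclidean.form_sub_self (hB : IsEuclidean B) {x y : E} (hx : B x x = 2)
    (hy : B y y = 2) : B (x - y) (x - y) = 4 - 2 * B x y := by
  simp only [map_sub, LinearMap.sub_apply, hx, hy, hB.symm y x]
  ring

theorem IsEuclidean.form_le_two (hB : IsEuclidean B) {x y : E} (hx : B x x = 2)
    (hy : B y y = 2) : B x y ≤ 2 := by
  linarith [hB.form_sub_self hx hy, hB.nonneg (x - y)]

theorem IsEuclidean.eq_of_form_eq_two (hB : IsEuclidean B) {x y : E} (hx : B x x = 2)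
    (hy : B y y = 2) (hxy : B x y = 2) : x = y :=
  sub_eq_zero.1 (hB.eq_zero (by linarith [hB.form_sub_self hx hy]))

theorem form_neg_neg_self {y : E} (hy : B y y = 2) : B (-y) (-y) = 2 := by simp [hy]

theorem IsEuclidean.neg_two_le_form (hB : IsEuclidean B) {x y : E} (hx : B x x = 2)
    (hy : B y y = 2) : -2 ≤ B x y := by
  have h := hB.form_le_two hx (form_neg_neg_self hy)
  rw [map_neg] at h
  linarith

theorem IsEuclidean.eq_neg_of_form_eq_neg_two (hB : IsEuclidean B) {x y : E} (hx : B x x = 2)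
    (hy : B y y = 2) (hxy : B x y = -2) : x = -y :=
  hB.eq_of_form_eq_two hx (form_neg_neg_self hy) (by rw [map_neg, hxy, neg_neg])

end NormTwo

/-! ### Inner products of roots, and the root system property of Λ ∪ τΛ. -/

section GoldenRoots

variable {V : Type*} [NormedAddCommGroup V] [InnerProductSpace ℝ V] {Φ P : Set V}

theorem innerₗ_self_eq_two {α : V} (hα : inner ℝ α α = (2 : ℝ)) : innerₗ V α α = 2 := hα

theorem IsRootSystem.sub_smul_mem {Λ : Set V} (hΛ : IsRootSystem (innerₗ V) Λ)
    (hnorm : ∀ α ∈ Λ, inner ℝ α α = (2 : ℝ)) {u v : V} (hu : u ∈ Λ) (hv : v ∈ Λ) {t : ℝ}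
    (ht : inner ℝ u v = t) : v - t • u ∈ Λ := by
  have h := hΛ.reflection_mem u hu v hv
  rwa [reflection_apply_of_form_eq_two (innerₗ_self_eq_two (hnorm u hu)), innerₗ_apply_apply,
    real_inner_comm, ht] at h

/-- This is the image of u under the reflection in v followed by the reflection in u. -/
theorem IsRootSystem.smul_sub_smul_mem {Λ : Set V} (hΛ : IsRootSystem (innerₗ V) Λ)
    (hnorm : ∀ α ∈ Λ, inner ℝ α α = (2 : ℝ)) {u v : V} (hu : u ∈ Λ) (hv : v ∈ Λ) {t : ℝ}
    (ht : inner ℝ u v = t) : (t ^ 2 - 1) • u - t • v ∈ Λ := by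
  have h := hΛ.sub_smul_mem hnorm hu
    (hΛ.sub_smul_mem hnorm hv hu ((real_inner_comm _ _).trans ht)) (t := 2 - t ^ 2) (by
      rw [inner_sub_right, real_inner_smul_right, hnorm u hu, ht]; ring)
  convert h using 1
  module

namespace IsGoldenRootSystem

variable (h : IsGoldenRootSystem Φ P)

/-- Reflecting a positive non-simple root in a suitable simple root preserves the norm and lowers
the height, so the norm is that of a simple root. -/
theorem inner_root_self (h : IsGoldenRootSystem Φ P) : ∀ α ∈ Φ, inner ℝ α α = (2 : ℝ) := by
  obtain ⟨f, hf⟩ := GoldenFolding.exists_functional h.isSimpleSystem.linearIndepOn fun _ => 1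
  have hB := isEuclidean_innerₗ V
  have hpos : ∀ β ∈ positivePart Φ P, inner ℝ β β = (2 : ℝ) := by
    refine IsSimpleSystem.positivePart_induction h.isRootSystem f fun β hβ ih => ?_
    obtain ⟨γ, hγ, hpos⟩ := IsSimpleSystem.exists_form_pos hB h.isRootSystem hβ
    have hγΦ := h.isSimpleSystem.subset hγ
    by_cases hβγ : β = γ
    · exact hβγ ▸ h.inner_self γ hγ
    have h1 := h.isRootSystem.reflection_mem γ hγΦ β hβ.1
    have h2 := hB.form_reflection (h.isRootSystem.ne_zero hγΦ) β β
    have h3 := reflection_apply_of_form_eq_two (innerₗ_self_eq_two (h.inner_self γ hγ)) β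
    have h4 := h.isSimpleSystem.mem_positivePart_of_eq_add h.isRootSystem hβ hβγ hγ one_pos
      (v := reflection (innerₗ V) γ β) (d := -(innerₗ V β γ)) (by rw [h3]; module) h1
    rw [← innerₗ_apply_apply, ← h2]
    refine ih _ h4 ?_
    rw [h3, map_sub, map_smul, hf γ hγ, smul_eq_mul]
    linarith
  intro α hα
  rcases h.isSimpleSystem.mem_cone_or hα with h1 | h1
  · exact hpos α ⟨hα, h1⟩
  · have := hpos (-α) ⟨h.isRootSystem.neg_mem hB hα, h1⟩
    rwa [inner_neg_neg] at this

theorem form_incl_self {u : rootLattice P} (hu : (u : V) ∈ Φ) :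
    h.realForm (incl P u) (incl P u) = 2 := by
  have h1 := h.form_incl (u := u) (v := u) (a := 2) (b := 0)
    ((h.inner_root_self u hu).trans (by simp))
  exact_mod_cast h1

theorem form_tau_self {u : rootLattice P} (hu : (u : V) ∈ Φ) :
    h.realForm (incl P (tauEnd P u)) (incl P (tauEnd P u)) = 2 := by
  have h1 := h.form_tau_tau (u := u) (v := u) (a := 2) (b := 0)
    ((h.inner_root_self u hu).trans (by simp))
  rw [h1]
  norm_num

theorem form_self_of_mem_doubling {x : RealLattice P} (hx : x ∈ doubling P Φ) :
    h.realForm x x = 2 := by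
  obtain ⟨u, hu, rfl | rfl⟩ := mem_doubling.1 hx
  · exact h.form_incl_self hu
  · exact h.form_tau_self hu

theorem smul_notMem (h : IsGoldenRootSystem Φ P) {α : V} (hα : α ∈ Φ) : φ • α ∉ Φ := by
  intro h1
  have h2 := h.inner_root_self _ h1
  rw [real_inner_smul_left, real_inner_smul_right, h.inner_root_self α hα] at h2
  nlinarith [Real.goldenRatio_sq, Real.one_lt_goldenRatio]

/-- The possible inner products of two roots. -/
theorem inner_root_cases (h : IsGoldenRootSystem Φ P) {u v : rootLattice P} (hu : (u : V) ∈ Φ)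
    (hv : (v : V) ∈ Φ) : ∃ a b : ℤ, inner ℝ (u : V) (v : V) = a + b * φ ∧
      (b = 0 ∧ (a = 2 ∧ u = v ∨ a = -2 ∧ u = -v ∨ a = 0 ∨ a = 1 ∨ a = -1) ∨
        a = 0 ∧ (b = 1 ∨ b = -1) ∨ a = -1 ∧ b = 1 ∨ a = 1 ∧ b = -1) := by
  obtain ⟨a, b, hab⟩ := h.exists_inner_eq u v
  refine ⟨a, b, hab, ?_⟩
  have hB := h.isEuclidean
  have huu := h.form_incl_self hu
  have hvv := h.form_incl_self hv
  have htu := h.form_tau_self hu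
  have htv := h.form_tau_self hv
  have h1 := h.form_incl hab
  have h2 := h.form_incl_tau hab
  have h3 := h.form_tau_tau hab
  -- Here a = (u, v) and b = (u, τv) are pairings of vectors of norm 2. The values b = ±2 would give
  -- u = ±τv, which the norms in V forbid.
  have a1 : a ≤ 2 := by exact_mod_cast h1 ▸ hB.form_le_two huu hvv
  have a2 : -2 ≤ a := by exact_mod_cast h1 ▸ hB.neg_two_le_form huu hvv
  have b1 : b ≤ 2 := by exact_mod_cast h2 ▸ hB.form_le_two huu htv
  have b2 : -2 ≤ b := by exact_mod_cast h2 ▸ hB.neg_two_le_form huu htv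
  have b3 : b ≠ 2 := by
    intro hb
    have h4 := h.incl_injective (hB.eq_of_form_eq_two huu htv (by rw [h2, hb]; norm_num))
    exact h.smul_notMem hv (by rwa [← coe_tauEnd, ← h4])
  have b4 : b ≠ -2 := by
    intro hb
    have h4 := hB.eq_neg_of_form_eq_neg_two huu htv (by rw [h2, hb]; norm_num)
    rw [← map_neg] at h4
    have h5 := h.incl_injective h4
    refine h.smul_notMem hv ?_
    have h6 := h.isRootSystem.neg_mem (isEuclidean_innerₗ V) hu
    rwa [h5, Submodule.coe_neg, coe_tauEnd, neg_neg] at h6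
  have hφ := Real.one_lt_goldenRatio
  -- The values ±(1 + φ) violate the Cauchy–Schwarz inequality in V.
  have c1 : ¬(a = 1 ∧ b = 1) := by
    rintro ⟨rfl, rfl⟩
    have h4 := (isEuclidean_innerₗ V).form_le_two (innerₗ_self_eq_two (h.inner_root_self u hu))
      (innerₗ_self_eq_two (h.inner_root_self v hv))
    rw [innerₗ_apply_apply, hab] at h4
    push_cast at h4
    linarith
  have c2 : ¬(a = -1 ∧ b = -1) := by
    rintro ⟨rfl, rfl⟩
    have h4 := (isEuclidean_innerₗ V).neg_two_le_form
      (innerₗ_self_eq_two (h.inner_root_self u hu))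
      (innerₗ_self_eq_two (h.inner_root_self v hv))
    rw [innerₗ_apply_apply, hab] at h4
    push_cast at h4
    linarith
  have d1 : a = 2 → u = v ∧ b = 0 := by
    rintro rfl
    have h4 := h.incl_injective (hB.eq_of_form_eq_two huu hvv (by rw [h1]; norm_num))
    subst h4
    exact ⟨rfl, (golden_coeff_unique (c := 2) (d := 0)
      (hab.symm.trans ((h.inner_root_self u hu).trans (by simp)))).2⟩
  have d2 : a = -2 → u = -v ∧ b = 0 := by
    rintro rfl
    have h4 := hB.eq_neg_of_form_eq_neg_two huu hvv (by rw [h1]; norm_num)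
    rw [← map_neg] at h4
    have h5 := h.incl_injective h4
    subst h5
    rw [Submodule.coe_neg, inner_neg_left, h.inner_root_self v hv] at hab
    exact ⟨rfl, (golden_coeff_unique (c := -2) (d := 0) (hab.symm.trans (by simp))).2⟩
  by_cases e1 : a = 2
  · exact .inl ⟨(d1 e1).2, .inl ⟨e1, (d1 e1).1⟩⟩
  by_cases e2 : a = -2
  · exact .inl ⟨(d2 e2).2, .inr (.inl ⟨e2, (d2 e2).1⟩)⟩
  clear * - a1 a2 b1 b2 b3 b4 c1 c2 e1 e2
  have key : b = 0 ∧ (a = 0 ∨ a = 1 ∨ a = -1) ∨ a = 0 ∧ (b = 1 ∨ b = -1) ∨ a = -1 ∧ b = 1 ∨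
      a = 1 ∧ b = -1 := by omega
  exact key.imp_left fun h => ⟨h.1, .inr (.inr h.2)⟩

theorem reflection_incl {u v : rootLattice P} (hu : h.realForm (incl P u) (incl P u) = 2) {n : ℤ}
    (hn : h.realForm (incl P u) (incl P v) = n) :
    reflection h.realForm (incl P u) (incl P v) = incl P (v - n • u) := by
  rw [reflection_apply_of_form_eq_two hu, h.realForm_symm, hn, map_sub, map_zsmul,
    Int.cast_smul_eq_zsmul]

theorem incl_mem_doubling_of_coe {A : Set V} {u : rootLattice P}
    (hu : (u : V) ∈ A ∨ ∃ y ∈ A, φ • y = (u : V)) : incl P u ∈ doubling P A :=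
  hu.imp (fun h => ⟨u, h, rfl⟩) (fun h => ⟨u, h, rfl⟩)

/-- With ⟨u, v⟩ = t, the roots v - tu, u - tv, (t² - 1)u - tv, (t² - 1)v - tu and their negatives
lie in Λ. For every admissible t the reflected vector is u, v or one of these, or τ times such a
root, by φ² = φ + 1. -/
theorem reflection_mem_doubling {Λ : Set V} (hΛΦ : Λ ⊆ Φ) (hΛ : IsRootSystem (innerₗ V) Λ)
    {x y : RealLattice P} (hx : x ∈ doubling P Λ) (hy : y ∈ doubling P Λ) :
    reflection h.realForm x y ∈ doubling P Λ := by
  have hnorm : ∀ α ∈ Λ, inner ℝ α α = (2 : ℝ) := fun α hα => h.inner_root_self α (hΛΦ hα)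
  have hφ := Real.goldenRatio_sq
  have hB := isEuclidean_innerₗ V
  obtain ⟨u, hu, hux⟩ := mem_doubling.1 hx
  obtain ⟨v, hv, hvy⟩ := mem_doubling.1 hy
  obtain ⟨a, b, hab, hcases⟩ := h.inner_root_cases (hΛΦ hu) (hΛΦ hv)
  have huv := hΛ.sub_smul_mem hnorm hu hv hab
  have hvu := hΛ.sub_smul_mem hnorm hv hu ((real_inner_comm _ _).trans hab)
  have huvu := hΛ.smul_sub_smul_mem hnorm hu hv hab
  have hvuv := hΛ.neg_mem hB
    (hΛ.smul_sub_smul_mem hnorm hv hu ((real_inner_comm _ _).trans hab))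
  have hvu' := hΛ.neg_mem hB hvu
  have huvu' := hΛ.neg_mem hB huvu
  replace hcases : b = 0 ∨ a = 0 ∧ b = 1 ∨ a = 0 ∧ b = -1 ∨ a = -1 ∧ b = 1 ∨ a = 1 ∧ b = -1 := by
    clear * - hcases
    omega
  rcases hux with rfl | rfl <;> rcases hvy with rfl | rfl
  · rw [h.reflection_incl (h.form_incl_self (hΛΦ hu)) (h.form_incl hab)]
    apply incl_mem_doubling_of_coe
    rw [Submodule.coe_sub, Submodule.coe_smul_of_tower, ← Int.cast_smul_eq_zsmul ℝ]
    rcases hcases with rfl | ⟨rfl, rfl⟩ | ⟨rfl, rfl⟩ | ⟨rfl, rfl⟩ | ⟨rfl, rfl⟩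
    · left; simpa using huv
    · left; simpa using hv
    · left; simpa using hv
    · right; refine ⟨_, hvuv, ?_⟩
      push_cast
      match_scalars <;> grind
    · right; refine ⟨_, hvuv, ?_⟩
      push_cast
      match_scalars <;> grind
  · rw [h.reflection_incl (h.form_incl_self (hΛΦ hu)) (h.form_incl_tau hab)]
    apply incl_mem_doubling_of_coe
    rw [Submodule.coe_sub, Submodule.coe_smul_of_tower, ← Int.cast_smul_eq_zsmul ℝ, coe_tauEnd]
    rcases hcases with rfl | ⟨rfl, rfl⟩ | ⟨rfl, rfl⟩ | ⟨rfl, rfl⟩ | ⟨rfl, rfl⟩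
    · right; exact ⟨v, hv, by simp⟩
    · left; convert hvu' using 1; push_cast; module
    · left; convert hvu using 1; push_cast; module
    · right; refine ⟨_, huv, ?_⟩
      push_cast
      match_scalars <;> grind
    · right; refine ⟨_, huv, ?_⟩
      push_cast
      match_scalars <;> grind
  · rw [h.reflection_incl (h.form_tau_self (hΛΦ hu)) (h.form_tau_incl hab)]
    apply incl_mem_doubling_of_coe
    rw [Submodule.coe_sub, Submodule.coe_smul_of_tower, ← Int.cast_smul_eq_zsmul ℝ, coe_tauEnd]
    rcases hcases with rfl | ⟨rfl, rfl⟩ | ⟨rfl, rfl⟩ | ⟨rfl, rfl⟩ | ⟨rfl, rfl⟩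
    · left; simpa using hv
    · left; convert huv using 1; push_cast; module
    · left; convert huv using 1; push_cast; module
    · right; refine ⟨_, hvu', ?_⟩
      push_cast
      match_scalars <;> grind
    · right; refine ⟨_, hvu, ?_⟩
      push_cast
      match_scalars <;> grind
  · rw [h.reflection_incl (h.form_tau_self (hΛΦ hu)) (n := a + b)
      ((h.form_tau_tau hab).trans (by push_cast; rfl))]
    apply incl_mem_doubling_of_coe
    rw [Submodule.coe_sub, Submodule.coe_smul_of_tower, ← Int.cast_smul_eq_zsmul ℝ, coe_tauEnd,
      coe_tauEnd]
    rcases hcases with rfl | ⟨rfl, rfl⟩ | ⟨rfl, rfl⟩ | ⟨rfl, rfl⟩ | ⟨rfl, rfl⟩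
    · right; refine ⟨_, huv, ?_⟩
      push_cast
      module
    · left; convert huvu' using 1
      push_cast
      match_scalars <;> grind
    · left; convert huvu using 1
      push_cast
      match_scalars <;> grind
    · right; exact ⟨v, hv, by simp⟩
    · right; exact ⟨v, hv, by simp⟩

theorem isRootSystem_doubling {Λ : Set V} (hΛΦ : Λ ⊆ Φ) (hΛ : IsRootSystem (innerₗ V) Λ) :
    IsRootSystem h.realForm (doubling P Λ) := by
  have hnorm : ∀ x ∈ doubling P Λ, h.realForm x x = 2 := by
    intro x hx
    obtain ⟨u, hu, rfl | rfl⟩ := mem_doubling.1 hx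
    · exact h.form_incl_self (hΛΦ hu)
    · exact h.form_tau_self (hΛΦ hu)
  refine ⟨?_, ?_, fun x hx y hy => h.reflection_mem_doubling hΛΦ hΛ hx hy, ?_⟩
  · exact ((hΛ.finite.preimage Subtype.val_injective.injOn).image _).union
      (((hΛ.finite.image _).preimage Subtype.val_injective.injOn).image _)
  · intro h0
    have := hnorm 0 h0
    simp at this
  · intro x hx c hc
    have h1 := hnorm _ hc
    rw [map_smul, LinearMap.map_smul₂, smul_eq_mul, smul_eq_mul, hnorm x hx] at h1
    exact mul_self_eq_one_iff.1 (by linarith)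

end IsGoldenRootSystem

end GoldenRoots

/-! ### Reflection closures and transport along isometries. -/

section Reflections

variable {E : Type*} [AddCommGroup E] [Module ℝ E] {B : LinearMap.BilinForm ℝ E}

theorem reflection_map {T : E →ₗ[ℝ] E} (hT : ∀ x y, B (T x) (T y) = B x y) (α x : E) :
    reflection B (T α) (T x) = T (reflection B α x) := by
  rw [reflection_apply, reflection_apply, hT, hT, map_sub, map_smul]

/-- The smallest set that contains `I` and is stable under the reflections in `I`. -/
inductive ReflectionClosure (B : LinearMap.BilinForm ℝ E) (I : Set E) : E → Prop
  | base {γ : E} : γ ∈ I → ReflectionClosure B I γ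
  | step {γ β : E} : γ ∈ I → ReflectionClosure B I β → ReflectionClosure B I (reflection B γ β)

/-- The reflection in the image of α under the reflection in γ is the conjugate of the reflection in
α by that in γ, so stability under reflections in `I` suffices. -/
theorem ReflectionClosure.reflection_mem (hB : IsEuclidean B) {I : Set E} (hI : (0 : E) ∉ I)
    {α : E} (hα : ReflectionClosure B I α) :
    ∀ β, ReflectionClosure B I β → ReflectionClosure B I (reflection B α β) := by
  induction hα with
  | base hγ => exact fun β hβ => hβ.step hγ
  | @step γ α hγ _ ih =>
    intro β hβ
    have hγ0 : γ ≠ 0 := fun h0 => hI (h0 ▸ hγ)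
    rw [← hB.reflection_reflection hγ0 β, reflection_map (hB.form_reflection hγ0)]
    exact (ih _ (hβ.step hγ)).step hγ

theorem IsRootSystem.map {T : E ≃ₗ[ℝ] E} (hT : ∀ x y, B (T x) (T y) = B x y) {Λ : Set E}
    (hΛ : IsRootSystem B Λ) : IsRootSystem B (T '' Λ) where
  finite := hΛ.finite.image _
  zero_notMem := by
    rintro ⟨α, hα, h0⟩
    exact hΛ.ne_zero hα (T.map_eq_zero_iff.1 h0)
  reflection_mem := by
    rintro _ ⟨α, hα, rfl⟩ _ ⟨β, hβ, rfl⟩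
    have h1 := reflection_map (T := T.toLinearMap) hT α β
    exact h1.symm ▸ Set.mem_image_of_mem T (hΛ.reflection_mem α hα β hβ)
  reduced := by
    rintro _ ⟨α, hα, rfl⟩ c ⟨β, hβ, hc⟩
    rw [← map_smul] at hc
    exact hΛ.reduced α hα c (T.injective hc ▸ hβ)

theorem IsSimpleSystem.map {T : E ≃ₗ[ℝ] E} {Λ Γ : Set E} (h0 : (0 : E) ∉ Λ)
    (hneg : ∀ α ∈ Λ, -α ∈ Λ) (hΓ : IsSimpleSystem Λ Γ) : IsSimpleSystem (T '' Λ) (T '' Γ) := by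
  refine IsSimpleSystem.of_forall (Set.image_mono hΓ.subset) ?_ ?_ ?_ ?_
  · have h1 : LinearIndependent ℝ (fun x : Γ => (x : E)) := hΓ.linearIndepOn
    have h2 : LinearIndepOn ℝ T Γ := h1.map' T.toLinearMap (LinearMap.ker_eq_bot.2 T.injective)
    exact h2.id_image
  · rintro ⟨α, hα, h1⟩
    rw [T.map_eq_zero_iff.1 h1] at hα
    exact h0 hα
  · rintro _ ⟨α, hα, rfl⟩
    exact ⟨-α, hneg α hα, map_neg _ _⟩
  · rintro _ ⟨α, hα, rfl⟩
    have h1 : ∀ v ∈ Submodule.span ℝ≥0 Γ, T v ∈ Submodule.span ℝ≥0 (T '' Γ) := fun v hv =>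
      map_mem_cone T.toLinearMap (fun γ hγ => Submodule.subset_span (Set.mem_image_of_mem T hγ)) hv
    refine (hΓ.mem_cone_or hα).imp (h1 α) fun h2 => ?_
    rw [← map_neg]
    exact h1 _ h2

end Reflections

/-! ### Simple systems Γ ∪ τΓ, bundles, and the bijection of root subsystems. -/

section Subsystems

variable {V : Type*} [NormedAddCommGroup V] [InnerProductSpace ℝ V] {Φ P : Set V}

namespace IsGoldenRootSystem

variable (h : IsGoldenRootSystem Φ P)

/-- Root subsystems satisfy the same hypotheses as `Φ`. -/
theorem subsystem (h : IsGoldenRootSystem Φ P) {Λ Γ : Set V} (hΛ : IsRootSubsystem (innerₗ V) Φ Λ)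
    (hΓ : IsSimpleSystem Λ Γ) : IsGoldenRootSystem Λ Γ where
  isRootSystem := hΛ.2
  isSimpleSystem := hΓ
  inner_self α hα := h.inner_root_self α (hΛ.1 (hΓ.subset hα))
  inner_of_ne α hα β hβ hne := by
    have hαΦ := hΛ.1 (hΓ.subset hα)
    have hβΦ := hΛ.1 (hΓ.subset hβ)
    have hB := isEuclidean_innerₗ V
    have hle := hΓ.form_nonpos hB hΛ.2 hα hβ hne
    rw [innerₗ_apply_apply] at hle
    have hφ := Real.one_lt_goldenRatio
    obtain ⟨a, b, hab, hc⟩ := h.inner_root_cases (u := ⟨α, h.root_mem_rootLattice hαΦ⟩)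
      (v := ⟨β, h.root_mem_rootLattice hβΦ⟩) hαΦ hβΦ
    simp only at hab
    rcases hc with ⟨rfl, ⟨rfl, h1⟩ | ⟨rfl, h1⟩ | rfl | rfl | rfl⟩ | ⟨rfl, rfl | rfl⟩ | ⟨rfl, rfl⟩ |
      ⟨rfl, rfl⟩
    · exact absurd (congrArg Subtype.val h1) hne
    · have h2 : α = -β := congrArg Subtype.val h1
      have h3 := eq_zero_of_mem_cone_of_neg_mem_cone hΓ.linearIndepOn
        (Submodule.subset_span hβ) (h2 ▸ Submodule.subset_span hα)
      exact absurd h3 (hΛ.2.ne_zero (hΓ.subset hβ))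
    · left; simpa using hab
    · rw [hab] at hle; norm_num at hle
    · right; left; simpa using hab
    · rw [hab] at hle; push_cast at hle; linarith
    · right; right; simpa using hab
    · rw [hab] at hle; push_cast at hle; linarith
    · exfalso
      -- For t = ⟨α, β⟩ = 1 - φ one has t² - 1 = t, so Λ contains (φ - 1)(β - α), a root with
      -- coefficients of both signs.
      have h1 := hΛ.2.smul_sub_smul_mem (fun γ hγ => h.inner_root_self γ (hΛ.1 hγ))
        (hΓ.subset hα) (hΓ.subset hβ) hab
      refine hΓ.smul_sub_smul_notMem hβ hα hne.symm (c := φ - 1) (d := φ - 1) (by linarith)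
        (by linarith) ?_
      convert h1 using 1
      push_cast
      match_scalars
      · ring
      · linear_combination -Real.goldenRatio_sq

/-- The family `Γ ∪ τΓ`, indexed by two copies of `Γ`. -/
def doublingFamily {Γ : Set V} (hΓ : Γ ⊆ rootLattice P) : Γ ⊕ Γ → RealLattice P :=
  Sum.elim (fun i => incl P ⟨i, hΓ i.2⟩) (fun i => incl P (tauEnd P ⟨i, hΓ i.2⟩))

theorem range_doublingFamily {Γ : Set V} (hΓ : Γ ⊆ rootLattice P) :
    Set.range (doublingFamily hΓ) = doubling P Γ := by
  ext x
  rw [mem_doubling]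
  constructor
  · rintro ⟨i | i, rfl⟩
    · exact ⟨⟨i, hΓ i.2⟩, i.2, .inl rfl⟩
    · exact ⟨⟨i, hΓ i.2⟩, i.2, .inr rfl⟩
  · rintro ⟨u, hu, rfl | rfl⟩
    · exact ⟨.inl ⟨u, hu⟩, rfl⟩
    · exact ⟨.inr ⟨u, hu⟩, rfl⟩

theorem incl_ne_incl_tau (h : IsGoldenRootSystem Φ P) {u v : rootLattice P} (hu : (u : V) ∈ Φ)
    (hv : (v : V) ∈ Φ) : incl P u ≠ incl P (tauEnd P v) := by
  intro h0
  have h1 := h.incl_injective h0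
  exact h.smul_notMem hv (by rwa [← coe_tauEnd, ← h1])

theorem tauEnd_injective : Function.Injective (tauEnd P) := by
  intro u v huv
  have h1 := congrArg Subtype.val huv
  rw [coe_tauEnd, coe_tauEnd] at h1
  exact Subtype.ext (smul_right_injective V Real.goldenRatio_ne_zero h1)

theorem doublingFamily_injective (h : IsGoldenRootSystem Φ P) {Γ : Set V}
    (hΓ : Γ ⊆ rootLattice P) (hΓΦ : Γ ⊆ Φ) : Function.Injective (doublingFamily hΓ) := by
  rintro (i | i) (j | j) hij
  · have h1 := congrArg Subtype.val (h.incl_injective hij)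
    exact congrArg _ (Subtype.ext h1)
  · exact absurd hij (h.incl_ne_incl_tau (hΓΦ i.2) (hΓΦ j.2))
  · exact absurd hij.symm (h.incl_ne_incl_tau (hΓΦ j.2) (hΓΦ i.2))
  · have h1 := congrArg Subtype.val (tauEnd_injective (h.incl_injective hij))
    exact congrArg _ (Subtype.ext h1)

/-- A relation among Γ ∪ τΓ is a vector of norm 0, so `realForm_sum_pos` makes its coefficients
vanish. -/
theorem linearIndepOn_doubling (h : IsGoldenRootSystem Φ P) {Λ Γ : Set V} (hΛΦ : Λ ⊆ Φ)
    (hΓ : IsGoldenRootSystem Λ Γ) : LinearIndepOn ℝ id (doubling P Γ) := by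
  have := hΓ.finite_simple.fintype
  have hΓU : Γ ⊆ rootLattice P := fun v hv =>
    h.root_mem_rootLattice (hΛΦ (hΓ.isSimpleSystem.subset hv))
  rw [← range_doublingFamily hΓU]
  refine LinearIndependent.linearIndepOn_id (Fintype.linearIndependent_iff.2 fun c hc => ?_)
  have key := h.realForm_sum_pos (fun i : Γ => ⟨i, hΓU i.2⟩)
    hΓ.isSimpleSystem.linearIndepOn (fun i => hΓ.inner_self i i.2)
    (fun i j hij => hΓ.inner_of_ne i i.2 j j.2 fun h0 => hij (Subtype.ext h0))
    (fun i => c (.inl i)) (fun i => c (.inr i))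
  rw [Fintype.sum_sum_type] at hc
  rw [Finset.sum_add_distrib] at key
  simp only [doublingFamily, Sum.elim_inl, Sum.elim_inr] at hc
  rw [hc, map_zero] at key
  by_contra! hne
  refine lt_irrefl _ (key ?_)
  by_contra! h0
  obtain ⟨i | i, hi⟩ := hne
  · exact hi (congrFun h0.1 i)
  · exact hi (congrFun h0.2 i)

/-- Induction on the height of β, with a simple γ such that ⟨β, γ⟩ > 0. For β ≠ γ this inner product
is 1, φ or φ - 1, and in each case β and τβ are sums of γ, τγ and vectors δ, τδ with δ a lower
positive root. -/
theorem incl_mem_cone_of_mem_positivePart (h : IsGoldenRootSystem Φ P) {Λ Γ : Set V}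
    (hΛΦ : Λ ⊆ Φ) (hΓ : IsGoldenRootSystem Λ Γ) : ∀ β ∈ positivePart Λ Γ,
      ∀ u : rootLattice P, (u : V) = β →
        incl P u ∈ Submodule.span ℝ≥0 (doubling P Γ) ∧
        incl P (tauEnd P u) ∈ Submodule.span ℝ≥0 (doubling P Γ) := by
  obtain ⟨f, hf⟩ := GoldenFolding.exists_functional hΓ.isSimpleSystem.linearIndepOn fun _ => 1
  have hB := isEuclidean_innerₗ V
  have hφ1 := Real.one_lt_goldenRatio
  have hφ2 := Real.goldenRatio_lt_two
  have hΛ := hΓ.isRootSystem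
  have hS := hΓ.isSimpleSystem
  have hmem : ∀ u : rootLattice P, (u : V) ∈ Γ →
      incl P u ∈ Submodule.span ℝ≥0 (doubling P Γ) ∧
      incl P (tauEnd P u) ∈ Submodule.span ℝ≥0 (doubling P Γ) := fun u hu =>
    ⟨Submodule.subset_span (incl_mem_doubling hu), Submodule.subset_span (incl_tau_mem_doubling hu)⟩
  refine IsSimpleSystem.positivePart_induction hΛ f fun β hβ ih u hu => ?_
  obtain ⟨γ, hγ, hpos⟩ := IsSimpleSystem.exists_form_pos hB hΛ hβ
  by_cases hβγ : β = γ
  · exact hmem u (by rwa [hu, hβγ])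
  have hγΦ := hΛΦ (hS.subset hγ)
  set w : rootLattice P := ⟨γ, h.root_mem_rootLattice hγΦ⟩ with hw
  have hwγ := hmem w hγ
  have hnorm := hΓ.inner_root_self
  have hfγ : f γ = 1 := hf γ hγ
  have hfβ : 0 ≤ f β := map_nonneg_of_mem_cone f (fun δ hδ => by rw [hf δ hδ]; norm_num) hβ.2
  obtain ⟨a, b, hab, hc⟩ := h.inner_root_cases (u := u) (v := w) (hu ▸ hΛΦ hβ.1) hγΦ
  have hab' : inner ℝ β γ = a + b * φ := by rw [← hab, hu]
  have hab'' := (real_inner_comm _ _).trans hab'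
  rw [innerₗ_apply_apply, hab'] at hpos
  have hδ := hΛ.sub_smul_mem hnorm (hS.subset hγ) hβ.1 hab''
  have hε := hΛ.neg_mem hB (hΛ.sub_smul_mem hnorm hβ.1 (hS.subset hγ) hab')
  rcases hc with ⟨rfl, ⟨rfl, h1⟩ | ⟨rfl, h1⟩ | rfl | rfl | rfl⟩ | ⟨rfl, rfl | rfl⟩ | ⟨rfl, rfl⟩ |
      ⟨rfl, rfl⟩
  · exact absurd (hu.symm.trans (congrArg Subtype.val h1)) hβγ
  · norm_num at hpos
  · norm_num at hpos
  · have h1 : ((u - w : rootLattice P) : V) = β - (((1 : ℤ) : ℝ) + ((0 : ℤ) : ℝ) * φ) • γ := by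
      rw [Submodule.coe_sub, hu]; push_cast; module
    have h2 := ih _ (hS.mem_positivePart_of_eq_add hΛ hβ hβγ hγ one_pos
      (v := _) (d := -1) (by push_cast; module) hδ) (by
        rw [map_sub, map_smul, hfγ, smul_eq_mul]; push_cast; linarith) (u - w) h1
    have h3 : u = (u - w) + w := by abel
    rw [h3, map_add, map_add, map_add]
    exact ⟨add_mem h2.1 hwγ.1, add_mem h2.2 hwγ.2⟩
  · norm_num at hpos
  -- Case ⟨β, γ⟩ = φ: use β = δ + τγ and τβ = τδ + τγ + γ with δ = β - φγ.
  · have h1 : ((u - tauEnd P w : rootLattice P) : V) =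
        β - (((0 : ℤ) : ℝ) + ((1 : ℤ) : ℝ) * φ) • γ := by
      rw [Submodule.coe_sub, hu, coe_tauEnd]; push_cast; module
    have h2 := ih _ (hS.mem_positivePart_of_eq_add hΛ hβ hβγ hγ one_pos
      (v := _) (d := -φ) (by push_cast; module) hδ) (by
        rw [map_sub, map_smul, hfγ, smul_eq_mul]; push_cast; linarith) (u - tauEnd P w) h1
    have h3 : u = (u - tauEnd P w) + tauEnd P w := by abel
    rw [h3, map_add, map_add, map_add, tauEnd_tauEnd, map_add]
    exact ⟨add_mem h2.1 hwγ.2, add_mem h2.2 (add_mem hwγ.2 hwγ.1)⟩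
  · push_cast at hpos; linarith
  -- Case ⟨β, γ⟩ = φ - 1: subtracting (τ - 1)γ from β would leave a negative coefficient at γ
  -- itself. Instead γ is reflected in β, and ε = (φ - 1)β - γ is a lower positive root with β = τε
  -- + τγ.
  · have h1 : ((tauEnd P u - u - w : rootLattice P) : V) =
        -(γ - (((-1 : ℤ) : ℝ) + ((1 : ℤ) : ℝ) * φ) • β) := by
      rw [Submodule.coe_sub, Submodule.coe_sub, coe_tauEnd, hu]; push_cast; module
    have h2 := ih _ (hS.mem_positivePart_of_eq_add hΛ hβ hβγ hγ (c := φ - 1) (by linarith)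
      (v := _) (d := -1) (by push_cast; module) hε) (by
        rw [map_neg, map_sub, map_smul, hfγ, smul_eq_mul]; push_cast; nlinarith)
      (tauEnd P u - u - w) h1
    have h3 : u = tauEnd P (tauEnd P u - u - w) + tauEnd P w := by
      rw [map_sub, map_sub, tauEnd_tauEnd]; abel
    have h4 : tauEnd P u = tauEnd P (tauEnd P u - u - w) + (tauEnd P u - u - w) +
        (tauEnd P w + w) := by
      rw [map_sub, map_sub, tauEnd_tauEnd]; abel
    refine ⟨?_, ?_⟩
    · rw [h3, map_add]
      exact add_mem h2.2 hwγ.2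
    · rw [h4, map_add, map_add, map_add]
      exact add_mem (add_mem h2.2 h2.1) (add_mem hwγ.2 hwγ.1)
  · push_cast at hpos; linarith

theorem isSimpleSystem_doubling (h : IsGoldenRootSystem Φ P) {Λ Γ : Set V} (hΛ : IsRootSubsystem (innerₗ V) Φ Λ)
    (hΓ : IsSimpleSystem Λ Γ) : IsSimpleSystem (doubling P Λ) (doubling P Γ) := by
  have hS := h.subsystem hΛ hΓ
  have hR := h.isRootSystem_doubling hΛ.1 hΛ.2
  have hcone := h.incl_mem_cone_of_mem_positivePart hΛ.1 hS
  refine IsSimpleSystem.of_forall ?_ (h.linearIndepOn_doubling hΛ.1 hS) hR.zero_notMem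
    (fun x hx => hR.neg_mem h.isEuclidean hx) ?_
  · intro x hx
    obtain ⟨u, hu, hux⟩ := mem_doubling.1 hx
    exact mem_doubling.2 ⟨u, hΓ.subset hu, hux⟩
  · intro x hx
    obtain ⟨u, hu, hux⟩ := mem_doubling.1 hx
    rcases hΓ.mem_cone_or hu with h1 | h1
    · have h2 := hcone u ⟨hu, h1⟩ u rfl
      left
      rcases hux with rfl | rfl
      exacts [h2.1, h2.2]
    · have h2 := hcone (-u) ⟨hΛ.2.neg_mem (isEuclidean_innerₗ V) hu, h1⟩ (-u) rfl
      rw [map_neg, map_neg, map_neg] at h2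
      right
      rcases hux with rfl | rfl
      exacts [h2.1, h2.2]

/-! ### Unions of bundles -/

theorem isUnionOfBundles_iff {A : Set (RealLattice P)} :
    IsUnionOfBundles Φ P A ↔ ∃ I ⊆ Φ, A = doubling P I := by
  refine exists_congr fun I => and_congr_right fun _ => ?_
  suffices hI : ⋃ α ∈ I, bundle P α = doubling P I by rw [hI]
  ext x
  simp only [Set.mem_iUnion, bundle, mem_embed, doubling, Set.mem_union]
  constructor
  · rintro ⟨α, hα, u, rfl | hu, rfl⟩
    · exact .inl ⟨u, hα, rfl⟩
    · exact .inr ⟨u, ⟨α, hα, hu.symm⟩, rfl⟩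
  · rintro (⟨u, hu, rfl⟩ | ⟨u, ⟨α, hα, hu⟩, rfl⟩)
    · exact ⟨u, hu, u, .inl rfl, rfl⟩
    · exact ⟨α, hα, u, .inr hu.symm, rfl⟩

theorem incl_mem_doubling_iff (h : IsGoldenRootSystem Φ P) {A : Set V} (hA : A ⊆ Φ)
    {u : rootLattice P} (hu : (u : V) ∈ Φ) : incl P u ∈ doubling P A ↔ (u : V) ∈ A := by
  refine ⟨fun hmem => ?_, incl_mem_doubling⟩
  obtain ⟨v, hv, hvu | hvu⟩ := mem_doubling.1 hmem
  · rwa [← h.incl_injective hvu]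
  · exact absurd hvu.symm (h.incl_ne_incl_tau hu (hA hv))

theorem doubling_subset_iff (h : IsGoldenRootSystem Φ P) {A A' : Set V} (hA : A ⊆ Φ)
    (hA' : A' ⊆ Φ) : doubling P A ⊆ doubling P A' ↔ A ⊆ A' := by
  constructor
  · intro hs v hv
    have hvU := h.root_mem_rootLattice (hA hv)
    exact (h.incl_mem_doubling_iff (u := ⟨v, hvU⟩) hA' (hA hv)).1 (hs (incl_mem_doubling hv))
  · intro hs x hx
    obtain ⟨u, hu, hux⟩ := mem_doubling.1 hx
    exact mem_doubling.2 ⟨u, hs hu, hux⟩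

theorem doubling_injOn (h : IsGoldenRootSystem Φ P) : Set.InjOn (doubling P) {A | A ⊆ Φ} :=
  fun _ hA _ hA' heq => ((h.doubling_subset_iff hA hA').1 heq.le).antisymm
    ((h.doubling_subset_iff hA' hA).1 heq.ge)

theorem disjoint_embed (h : IsGoldenRootSystem Φ P) :
    Disjoint (embed P Φ) (embed P ((fun v : V => φ • v) '' Φ)) := by
  rw [Set.disjoint_left]
  intro x hx hx'
  obtain ⟨u, hu, rfl⟩ := mem_embed.1 hx
  obtain ⟨v, hv, hvu⟩ := mem_embed_smul.1 hx'
  exact h.incl_ne_incl_tau hu hv hvu.symm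

/-- The reflection in `α` acts on `U` as the product of the reflections in `α` and `τα`. -/
theorem reflection_reflection_incl {u v w : rootLattice P} (hu : (u : V) ∈ Φ)
    (hw : (w : V) = reflection (innerₗ V) (u : V) (v : V)) :
    reflection h.realForm (incl P u) (reflection h.realForm (incl P (tauEnd P u)) (incl P v)) =
      incl P w := by
  obtain ⟨a, b, hab⟩ := h.exists_inner_eq u v
  -- ⟨u, u⟩ = 2 has no τ-part, so u and τu are orthogonal. The two reflections then subtract bτu and
  -- au independently, in total (a + bτ)u.
  obtain ⟨c, d, hcd⟩ := h.exists_inner_eq u u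
  have hcd' := golden_coeff_unique (c := 2) (d := 0)
    (hcd.symm.trans ((h.inner_root_self u hu).trans (by simp)))
  rw [h.reflection_incl (h.form_tau_self hu) (h.form_tau_incl hab),
    h.reflection_incl (n := a) (h.form_incl_self hu)]
  · congr 1
    ext
    rw [hw, reflection_apply_of_form_eq_two (innerₗ_self_eq_two (h.inner_root_self u hu)),
      innerₗ_apply_apply, real_inner_comm, hab]
    simp only [Submodule.coe_sub, Submodule.coe_smul_of_tower, coe_tauEnd,
      ← Int.cast_smul_eq_zsmul ℝ]
    module
  · rw [map_sub, map_zsmul, map_sub, map_zsmul, h.form_incl hab, h.form_incl_tau hcd, hcd'.2]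
    simp

theorem isRootSubsystem_of_doubling {Λ : Set V} (hΛΦ : Λ ⊆ Φ)
    (hΛ : IsRootSystem h.realForm (doubling P Λ)) : IsRootSubsystem (innerₗ V) Φ Λ := by
  refine ⟨hΛΦ, h.isRootSystem.finite.subset hΛΦ, fun h0 => h.isRootSystem.zero_notMem (hΛΦ h0),
    fun α hα β hβ => ?_, fun α hα c hc => h.isRootSystem.reduced α (hΛΦ hα) c (hΛΦ hc)⟩
  have hαβ := h.isRootSystem.reflection_mem α (hΛΦ hα) β (hΛΦ hβ)
  set u : rootLattice P := ⟨α, h.root_mem_rootLattice (hΛΦ hα)⟩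
  set v : rootLattice P := ⟨β, h.root_mem_rootLattice (hΛΦ hβ)⟩
  set w : rootLattice P := ⟨_, h.root_mem_rootLattice hαβ⟩
  have h1 := h.reflection_reflection_incl (u := u) (v := v) (w := w) (hΛΦ hα) rfl
  have h2 := hΛ.reflection_mem (incl P u) (incl_mem_doubling hα) _
    (hΛ.reflection_mem (incl P (tauEnd P u)) (incl_tau_mem_doubling hα) (incl P v)
      (incl_mem_doubling hβ))
  rw [h1] at h2
  exact (h.incl_mem_doubling_iff hΛΦ (u := w) hαβ).1 h2

theorem bijOn_rootSubsystem : Set.BijOn (doubling P)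
    {Λ | IsRootSubsystem (innerₗ V) Φ Λ}
    {Λ' | IsRootSubsystem h.realForm (doubling P Φ) Λ' ∧ IsUnionOfBundles Φ P Λ'} := by
  refine ⟨fun Λ hΛ => ⟨⟨?_, h.isRootSystem_doubling hΛ.1 hΛ.2⟩,
    isUnionOfBundles_iff.2 ⟨Λ, hΛ.1, rfl⟩⟩, h.doubling_injOn.mono fun Λ hΛ => hΛ.1, ?_⟩
  · exact (h.doubling_subset_iff hΛ.1 subset_rfl).2 hΛ.1
  · rintro Λ' ⟨hΛ', hb⟩
    obtain ⟨I, hI, rfl⟩ := isUnionOfBundles_iff.1 hb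
    exact ⟨I, h.isRootSubsystem_of_doubling hI hΛ'.2, rfl⟩

/-! ### Simple subsystems of `Ψ` which are unions of bundles -/

/-- A real relation among the roots of `I` is lifted to ℝ ⊗ U with a vanishing conjugate part. The
lift then has norm 0, is itself 0, and is a relation among I ∪ τI. -/
theorem linearIndepOn_of_doubling (h : IsGoldenRootSystem Φ P) {I : Set V} (hI : I ⊆ Φ)
    (hli : LinearIndepOn ℝ id (doubling P I)) : LinearIndepOn ℝ id I := by
  have := (h.isRootSystem.finite.subset hI).fintype
  have hIU : I ⊆ rootLattice P := fun v hv => h.root_mem_rootLattice (hI hv)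
  rw [← range_doublingFamily hIU, linearIndepOn_id_range_iff (h.doublingFamily_injective hIU hI),
    Fintype.linearIndependent_iff] at hli
  refine Fintype.linearIndependent_iff.2 fun c hc i => ?_
  choose A C hAC using fun i j : I => h.exists_inner_eq ⟨i, hIU i.2⟩ ⟨j, hIU j.2⟩
  have hφ1 := Real.one_lt_goldenRatio
  -- The coefficients a = (φ - 1)c and b = c give a + b(1 - φ) = 0 and a + bφ = (2φ - 1)c.
  have key := h.realForm_sum (fun i : I => ⟨i, hIU i.2⟩) hAC (fun i => (φ - 1) * c i) c
  have h1 : ∑ i : I, ((φ - 1) * c i + c i * φ) • (i : V) = 0 := by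
    rw [← smul_zero (2 * φ - 1), ← hc, Finset.smul_sum]
    refine Finset.sum_congr rfl fun i _ => ?_
    simp only [id]
    module
  have h2 : ∀ i j : I, ((φ - 1) * c i + c i * (1 - φ)) * ((φ - 1) * c j + c j * (1 - φ)) *
      (A i j + C i j * (1 - φ)) = 0 := fun i j => by ring
  simp only [h1, inner_zero_left, mul_zero, h2, Finset.sum_const_zero, add_zero] at key
  have h3 := h.isEuclidean.eq_zero ((mul_eq_zero.1 key).resolve_left (by linarith)).le
  have h4 := hli (Sum.elim (fun i => (φ - 1) * c i) c) (by
    rw [Fintype.sum_sum_type, ← h3, Finset.sum_add_distrib]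
    rfl)
  exact h4 (.inr i)

/-- The projection `ℝ ⊗ U → V` extending the inclusion of `U`. -/
def proj (P : Set V) : RealLattice P →ₗ[ℝ] V :=
  LinearMap.liftBaseChange ℝ (rootLattice P).subtype.toAddMonoidHom.toIntLinearMap

theorem proj_incl (u : rootLattice P) : proj P (incl P u) = (u : V) := by
  rw [proj, incl_apply, LinearMap.liftBaseChange_tmul, one_smul]
  rfl

end IsGoldenRootSystem

end Subsystems

/-! ### The bijection of simple subsystems, equivariance, and chambers. -/

section Bijections

variable {V : Type*} [NormedAddCommGroup V] [InnerProductSpace ℝ V] {Φ P : Set V}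

theorem weylGroup_form {E : Type*} [AddCommGroup E] [Module ℝ E] {B : LinearMap.BilinForm ℝ E}
    (hB : IsEuclidean B) {A : Set E} (hA : (0 : E) ∉ A) {w : E ≃ₗ[ℝ] E} (hw : w ∈ weylGroup B A) :
    ∀ x y, B (w x) (w y) = B x y := by
  induction hw using Subgroup.closure_induction with
  | mem g hg =>
    obtain ⟨α, hα, hgα⟩ := hg
    intro x y
    have h1 : ∀ z, g z = reflection B α z := LinearMap.congr_fun hgα
    rw [h1, h1]
    exact hB.form_reflection (fun h0 => hA (h0 ▸ hα)) x y
  | one => exact fun x y => rfl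
  | mul g k _ _ hg hk => exact fun x y => (hg _ _).trans (hk x y)
  | inv g _ hg =>
    intro x y
    have h1 : ∀ z, g (g⁻¹ z) = z := g.apply_symm_apply
    rw [← hg, h1, h1]

namespace IsGoldenRootSystem

variable (h : IsGoldenRootSystem Φ P)

/-- The root subsystem of Φ is the reflection closure of `I`. Its image lies in the given root
system Λ', because the reflection in γ acts on U as the product of the reflections in γ and τγ, both
of which preserve Λ'. -/
theorem isSimpleSubsystem_of_doubling {I : Set V} (hI : I ⊆ Φ)
    (hI' : IsSimpleSubsystem h.realForm (doubling P Φ) (doubling P I)) :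
    IsSimpleSubsystem (innerₗ V) Φ I := by
  obtain ⟨Λ', ⟨-, hR⟩, hS⟩ := hI'
  have hB := isEuclidean_innerₗ V
  have hI0 : (0 : V) ∉ I := fun h0 => h.isRootSystem.zero_notMem (hI h0)
  have hmem : ∀ β, ReflectionClosure (innerₗ V) I β →
      β ∈ Φ ∧ ∀ u : rootLattice P, (u : V) = β → incl P u ∈ Λ' := by
    intro β hβ
    induction hβ with
    | base hγ => exact ⟨hI hγ, fun u hu => hS.subset (incl_mem_doubling (hu ▸ hγ))⟩
    | @step γ β hγ _ ih =>
      refine ⟨h.isRootSystem.reflection_mem γ (hI hγ) β ih.1, fun w hw => ?_⟩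
      set u : rootLattice P := ⟨γ, h.root_mem_rootLattice (hI hγ)⟩
      set v : rootLattice P := ⟨β, h.root_mem_rootLattice ih.1⟩
      rw [← h.reflection_reflection_incl (u := u) (v := v) (w := w) (hI hγ) hw]
      exact hR.reflection_mem _ (hS.subset (incl_mem_doubling hγ)) _
        (hR.reflection_mem _ (hS.subset (incl_tau_mem_doubling hγ)) _ (ih.2 v rfl))
  have hΛ : IsRootSystem (innerₗ V) {β | ReflectionClosure (innerₗ V) I β} :=
    { finite := h.isRootSystem.finite.subset fun β hβ => (hmem β hβ).1
      zero_notMem := fun h0 => h.isRootSystem.zero_notMem (hmem 0 h0).1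
      reflection_mem := fun α hα β hβ => ReflectionClosure.reflection_mem hB hI0 hα β hβ
      reduced := fun α hα c hc => h.isRootSystem.reduced α (hmem α hα).1 c (hmem _ hc).1 }
  refine ⟨_, ⟨fun β hβ => (hmem β hβ).1, hΛ⟩, ?_⟩
  refine IsSimpleSystem.of_forall (fun γ hγ => .base hγ)
    (h.linearIndepOn_of_doubling hI hS.linearIndepOn) hΛ.zero_notMem
    (fun β hβ => hΛ.neg_mem hB hβ) fun β hβ => ?_
  -- The projection sends τγ to φγ, and φ > 0.
  have hproj : ∀ x ∈ Submodule.span ℝ≥0 (doubling P I), proj P x ∈ Submodule.span ℝ≥0 I := by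
    refine fun x hx => map_mem_cone (proj P) (fun y hy => ?_) hx
    obtain ⟨u, hu, rfl | rfl⟩ := mem_doubling.1 hy
    · rw [proj_incl]
      exact Submodule.subset_span hu
    · rw [proj_incl, coe_tauEnd]
      exact nnreal_smul_mem_cone (Submodule.subset_span hu) Real.goldenRatio_pos.le
  set u : rootLattice P := ⟨β, h.root_mem_rootLattice (hmem β hβ).1⟩ with hu
  refine (hS.mem_cone_or ((hmem β hβ).2 u rfl)).imp (fun h1 => ?_) (fun h1 => ?_)
  · simpa only [proj_incl] using hproj _ h1
  · simpa only [map_neg, proj_incl] using hproj _ h1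

theorem isSimpleSubsystem_doubling {Γ : Set V} (hΓ : IsSimpleSubsystem (innerₗ V) Φ Γ) :
    IsSimpleSubsystem h.realForm (doubling P Φ) (doubling P Γ) := by
  obtain ⟨Λ, hΛ, hS⟩ := hΓ
  exact ⟨doubling P Λ, ⟨(h.doubling_subset_iff hΛ.1 subset_rfl).2 hΛ.1,
    h.isRootSystem_doubling hΛ.1 hΛ.2⟩, h.isSimpleSystem_doubling hΛ hS⟩

theorem _root_.GoldenFolding.IsSimpleSubsystem.subset {E : Type*} [AddCommGroup E] [Module ℝ E]
    {B : LinearMap.BilinForm ℝ E} {A Γ : Set E} (hΓ : IsSimpleSubsystem B A Γ) : Γ ⊆ A := by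
  obtain ⟨Λ, hΛ, hS⟩ := hΓ
  exact hS.subset.trans hΛ.1

theorem bijOn_simpleSubsystem : Set.BijOn (doubling P)
    {Γ | IsSimpleSubsystem (innerₗ V) Φ Γ}
    {Γ' | IsSimpleSubsystem h.realForm (doubling P Φ) Γ' ∧ IsUnionOfBundles Φ P Γ'} := by
  refine ⟨fun Γ hΓ => ⟨h.isSimpleSubsystem_doubling hΓ,
    isUnionOfBundles_iff.2 ⟨Γ, IsSimpleSubsystem.subset hΓ, rfl⟩⟩,
    h.doubling_injOn.mono fun Γ hΓ => IsSimpleSubsystem.subset hΓ, ?_⟩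
  rintro Γ' ⟨hΓ', hb⟩
  obtain ⟨I, hI, rfl⟩ := isUnionOfBundles_iff.1 hb
  exact ⟨I, h.isSimpleSubsystem_of_doubling hI hΓ', rfl⟩

theorem isRootSubsystem_map (h : IsGoldenRootSystem Φ P) (w : weylGroup (innerₗ V) Φ) {Λ : Set V}
    (hΛ : IsRootSubsystem (innerₗ V) Φ Λ) :
    IsRootSubsystem (innerₗ V) Φ ((w : V ≃ₗ[ℝ] V) '' Λ) := by
  refine ⟨?_, hΛ.2.map (weylGroup_form (isEuclidean_innerₗ V) h.isRootSystem.zero_notMem w.2)⟩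
  rintro _ ⟨α, hα, rfl⟩
  exact h.weylGroup_apply_mem_root w.2 α (hΛ.1 hα)

theorem isSimpleSubsystem_map (h : IsGoldenRootSystem Φ P) (w : weylGroup (innerₗ V) Φ)
    {Γ : Set V} (hΓ : IsSimpleSubsystem (innerₗ V) Φ Γ) :
    IsSimpleSubsystem (innerₗ V) Φ ((w : V ≃ₗ[ℝ] V) '' Γ) := by
  obtain ⟨Λ, hΛ, hS⟩ := hΓ
  exact ⟨_, h.isRootSubsystem_map w hΛ, hS.map hΛ.2.zero_notMem
    fun α hα => hΛ.2.neg_mem (isEuclidean_innerₗ V) hα⟩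

theorem act_incl (w : weylGroup (innerₗ V) Φ) (u : rootLattice P) :
    h.act w (incl P u) = incl P (h.restrictLattice w u) := by
  rw [act, incl_apply, incl_apply, LinearMap.baseChange_tmul]

theorem restrictLattice_tauEnd (w : weylGroup (innerₗ V) Φ) (u : rootLattice P) :
    h.restrictLattice w (tauEnd P u) = tauEnd P (h.restrictLattice w u) := by
  ext
  rw [coe_tauEnd]
  exact map_smul (w : V ≃ₗ[ℝ] V) φ (u : V)

theorem doubling_map (w : weylGroup (innerₗ V) Φ) {A : Set V} (hA : A ⊆ Φ) :
    doubling P ((w : V ≃ₗ[ℝ] V) '' A) = h.act w '' doubling P A := by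
  ext x
  rw [mem_doubling]
  constructor
  · rintro ⟨u, ⟨α, hα, hαu⟩, hux⟩
    set v : rootLattice P := ⟨α, h.root_mem_rootLattice (hA hα)⟩ with hv
    have hvu : h.restrictLattice w v = u := Subtype.ext hαu
    rcases hux with rfl | rfl
    · exact ⟨incl P v, incl_mem_doubling hα, by rw [h.act_incl, hvu]⟩
    · exact ⟨incl P (tauEnd P v), incl_tau_mem_doubling hα, by
        rw [h.act_incl, h.restrictLattice_tauEnd, hvu]⟩
  · rintro ⟨y, hy, rfl⟩
    obtain ⟨u, hu, rfl | rfl⟩ := mem_doubling.1 hy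
    · exact ⟨h.restrictLattice w u, ⟨u, hu, rfl⟩, .inl (h.act_incl w u).symm⟩
    · exact ⟨h.restrictLattice w u, ⟨u, hu, rfl⟩, .inr (by
        rw [h.act_incl, h.restrictLattice_tauEnd])⟩

/-- For every admissible inner product, a + bφ ≥ 0 if and only if b ≥ 0 and a + b ≥ 0, the pairings
of τα with γ and τγ. With α in place of τα this fails: φ - 1 > 0, but there a = -1. -/
theorem mem_chamber_iff {Γ : Set V} (hΓ : Γ ⊆ Φ) {u : rootLattice P} (hu : (u : V) ∈ Φ) :
    (u : V) ∈ chamber (innerₗ V) Γ ↔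
      incl P (tauEnd P u) ∈ chamber h.realForm (doubling P Γ) := by
  have key : ∀ v : rootLattice P, (v : V) ∈ Γ → (0 ≤ inner ℝ (u : V) (v : V) ↔
      0 ≤ h.realForm (incl P (tauEnd P u)) (incl P v) ∧
      0 ≤ h.realForm (incl P (tauEnd P u)) (incl P (tauEnd P v))) := by
    intro v hv
    obtain ⟨a, b, hab, hc⟩ := h.inner_root_cases hu (hΓ hv)
    rw [h.form_tau_incl hab, h.form_tau_tau hab, hab]
    have hφ := Real.one_lt_goldenRatio
    rcases hc with ⟨rfl, ⟨rfl, -⟩ | ⟨rfl, -⟩ | rfl | rfl | rfl⟩ | ⟨rfl, rfl | rfl⟩ | ⟨rfl, rfl⟩ |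
      ⟨rfl, rfl⟩ <;> push_cast <;>
      exact ⟨fun _ => ⟨by linarith, by linarith⟩, fun h0 => by linarith [h0.1, h0.2]⟩
  constructor
  · intro hmem x hx
    obtain ⟨v, hv, rfl | rfl⟩ := mem_doubling.1 hx
    exacts [((key v hv).1 (hmem v hv)).1, ((key v hv).1 (hmem v hv)).2]
  · intro hmem γ hγ
    exact (key ⟨γ, h.root_mem_rootLattice (hΓ hγ)⟩ hγ).2
      ⟨hmem _ (incl_mem_doubling hγ), hmem _ (incl_tau_mem_doubling hγ)⟩

end IsGoldenRootSystem

end Bijections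

/-! ### Components of the Coxeter graph of Γ. -/

section Classification

variable {V : Type*} [NormedAddCommGroup V] [InnerProductSpace ℝ V] {Φ P Λ Γ C : Set V}

/-- Injectivity of `f` is automatic, since equal vectors would produce an off-diagonal entry 1. -/
theorem hasType_range {E ι : Type*} [AddCommGroup E] [Module ℝ E] {B : LinearMap.BilinForm ℝ E}
    (hB : IsEuclidean B) {f : ι → E} (hf : ∀ i, f i ≠ 0) {M : CoxeterMatrix ι}
    (hM : ∀ i j, coxeterEntry B (f i) (f j) = M i j) : HasType B (Set.range f) M := by
  have hinj : Function.Injective f := by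
    intro i j hij
    by_contra hne
    refine M.off_diagonal i j hne ?_
    rw [← hM, hij, coxeterEntry_self hB (hf j)]
  exact ⟨Equiv.ofInjective f hinj, hM⟩

/-- Half the norm of a combination of five vectors. With suitable coefficients it excludes diagrams;
smaller diagrams use coefficient 0. -/
theorem inner_five_nonneg {x₁ x₂ x₃ x₄ x₅ : V} (h₁ : inner ℝ x₁ x₁ = (2 : ℝ))
    (h₂ : inner ℝ x₂ x₂ = (2 : ℝ)) (h₃ : inner ℝ x₃ x₃ = (2 : ℝ)) (h₄ : inner ℝ x₄ x₄ = (2 : ℝ))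
    (h₅ : inner ℝ x₅ x₅ = (2 : ℝ)) (c₁ c₂ c₃ c₄ c₅ : ℝ) :
    0 ≤ c₁ ^ 2 + c₂ ^ 2 + c₃ ^ 2 + c₄ ^ 2 + c₅ ^ 2 +
      c₁ * c₂ * inner ℝ x₁ x₂ + c₁ * c₃ * inner ℝ x₁ x₃ + c₁ * c₄ * inner ℝ x₁ x₄ +
      c₁ * c₅ * inner ℝ x₁ x₅ + c₂ * c₃ * inner ℝ x₂ x₃ + c₂ * c₄ * inner ℝ x₂ x₄ +
      c₂ * c₅ * inner ℝ x₂ x₅ + c₃ * c₄ * inner ℝ x₃ x₄ + c₃ * c₅ * inner ℝ x₃ x₅ +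
      c₄ * c₅ * inner ℝ x₄ x₅ := by
  have h : 0 ≤ inner ℝ (c₁ • x₁ + c₂ • x₂ + c₃ • x₃ + c₄ • x₄ + c₅ • x₅)
      (c₁ • x₁ + c₂ • x₂ + c₃ • x₃ + c₄ • x₄ + c₅ • x₅) := real_inner_self_nonneg
  simp only [inner_add_left, inner_add_right, real_inner_smul_left, real_inner_smul_right,
    h₁, h₂, h₃, h₄, h₅, real_inner_comm x₁ x₂, real_inner_comm x₁ x₃, real_inner_comm x₁ x₄,
    real_inner_comm x₁ x₅, real_inner_comm x₂ x₃, real_inner_comm x₂ x₄, real_inner_comm x₂ x₅,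
    real_inner_comm x₃ x₄, real_inner_comm x₃ x₅, real_inner_comm x₄ x₅] at h
  linarith

namespace IsGoldenRootSystem

/-! ### Coxeter graphs with an edge labelled `5` -/

theorem entry_cases (hΓ : IsGoldenRootSystem Λ Γ) {α β : V} (hα : α ∈ Γ) (hβ : β ∈ Γ)
    (hne : α ≠ β) : (inner ℝ α β = (0 : ℝ) ∧ coxeterEntry (innerₗ V) α β = 2) ∨
      (inner ℝ α β = (-1 : ℝ) ∧ coxeterEntry (innerₗ V) α β = 3) ∨
      (inner ℝ α β = -φ ∧ coxeterEntry (innerₗ V) α β = 5) := by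
  have hB := isEuclidean_innerₗ V
  have h1 := innerₗ_self_eq_two (hΓ.inner_self α hα)
  have h2 := innerₗ_self_eq_two (hΓ.inner_self β hβ)
  rcases hΓ.inner_of_ne α hα β hβ hne with h3 | h3 | h3
  · exact .inl ⟨h3, coxeterEntry_eq_two hB h1 h2 h3⟩
  · exact .inr (.inl ⟨h3, coxeterEntry_eq_three hB h1 h2 h3⟩)
  · exact .inr (.inr ⟨h3, coxeterEntry_eq_five hB h1 h2 h3⟩)

theorem entry_self (hΓ : IsGoldenRootSystem Λ Γ) {α : V} (hα : α ∈ Γ) :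
    coxeterEntry (innerₗ V) α α = 1 :=
  coxeterEntry_self (isEuclidean_innerₗ V)
    (hΓ.isRootSystem.ne_zero (hΓ.isSimpleSystem.subset hα))

theorem hasOrthogonalEntries (hΓ : IsGoldenRootSystem Λ Γ) :
    HasOrthogonalEntries (innerₗ V) Γ := by
  intro α hα β hβ hne
  rw [innerₗ_apply_apply]
  have hφ := Real.goldenRatio_ne_zero
  rcases hΓ.entry_cases hα hβ hne with ⟨h1, h2⟩ | ⟨h1, h2⟩ | ⟨h1, h2⟩ <;> rw [h1, h2] <;> simp [hφ]

theorem inner_eq_of_entry_eq_five (hΓ : IsGoldenRootSystem Λ Γ) {α β : V} (hα : α ∈ Γ)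
    (hβ : β ∈ Γ) (h5 : coxeterEntry (innerₗ V) α β = 5) : inner ℝ α β = -φ := by
  have hne : α ≠ β := by
    rintro rfl
    rw [hΓ.entry_self hα] at h5
    omega
  rcases hΓ.entry_cases hα hβ hne with ⟨h1, h2⟩ | ⟨h1, h2⟩ | ⟨h1, h2⟩
  · omega
  · omega
  · exact h1

theorem golden_pow : φ ^ 2 = φ + 1 ∧ φ ^ 3 = 2 * φ + 1 ∧ φ ^ 4 = 3 * φ + 2 ∧ φ ^ 5 = 5 * φ + 3 := by
  have h2 := Real.goldenRatio_sq
  generalize φ = p at *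
  refine ⟨h2, ?_, ?_, ?_⟩ <;> grind

theorem golden_bounds : 1.6 < φ ∧ φ < 1.62 := by
  have h1 := Real.goldenRatio_sq
  have h2 := Real.one_lt_goldenRatio
  generalize φ = p at *
  constructor <;> nlinarith

theorem inner_of_adj_five (hΓ : IsGoldenRootSystem Λ Γ) {a b c : V} (ha : a ∈ Γ) (hb : b ∈ Γ)
    (hc : c ∈ Γ) (hca : a ≠ c) (hcb : b ≠ c) (hab : inner ℝ a b = -φ)
    (hbc : inner ℝ b c ≠ (0 : ℝ)) : inner ℝ a c = (0 : ℝ) ∧ inner ℝ b c = (-1 : ℝ) := by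
  have na := hΓ.inner_self a ha
  have nb := hΓ.inner_self b hb
  have nc := hΓ.inner_self c hc
  -- Half the norm of a + φb + c is 2 + ⟨a, c⟩ + φ⟨b, c⟩, which is negative in all cases with ⟨b, c⟩
  -- ≠ 0 but the claimed one.
  have key := inner_five_nonneg na nb nc na na 1 φ 1 0 0
  have h1 := hΓ.inner_of_ne a ha c hc hca
  have h2 := hΓ.inner_of_ne b hb c hc hcb
  obtain ⟨p2, -⟩ := golden_pow
  obtain ⟨q1, q2⟩ := golden_bounds
  rw [hab] at key
  generalize φ = p at *
  rcases h1 with h1 | h1 | h1 <;> rcases h2 with h2 | h2 | h2 <;> rw [h1, h2] at key <;>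
    first
      | exact absurd h2 hbc
      | exact ⟨h1, h2⟩
      | (exfalso; nlinarith)

theorem inner_of_ne_H₃ (hΓ : IsGoldenRootSystem Λ Γ) {a b c d : V} (ha : a ∈ Γ) (hb : b ∈ Γ)
    (hc : c ∈ Γ) (hd : d ∈ Γ) (had : a ≠ d) (hbd : b ≠ d) (hcd : c ≠ d)
    (hab : inner ℝ a b = -φ) (hac : inner ℝ a c = (0 : ℝ)) (hbc : inner ℝ b c = (-1 : ℝ)) :
    inner ℝ a d = (0 : ℝ) ∧ inner ℝ b d = (0 : ℝ) ∧
      (inner ℝ c d = (0 : ℝ) ∨ inner ℝ c d = (-1 : ℝ)) := by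
  have na := hΓ.inner_self a ha
  have nb := hΓ.inner_self b hb
  have nc := hΓ.inner_self c hc
  have nd := hΓ.inner_self d hd
  -- For each forbidden way of attaching d, at least one of these three vectors has negative norm.
  have key1 := inner_five_nonneg na nb nc nd na (φ + 1) (φ + 1) 1 1 0
  have key2 := inner_five_nonneg na nb nc nd na φ 2 1 1 0
  have key3 := inner_five_nonneg na nb nc nd na φ 2 2 φ 0
  have h1 := hΓ.inner_of_ne a ha d hd had
  have h2 := hΓ.inner_of_ne b hb d hd hbd
  have h3 := hΓ.inner_of_ne c hc d hd hcd
  obtain ⟨p2, p3, -, -⟩ := golden_pow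
  obtain ⟨q1, q2⟩ := golden_bounds
  rw [hab, hac, hbc] at key1 key2 key3
  generalize φ = p at *
  rcases h1 with h1 | h1 | h1 <;> rcases h2 with h2 | h2 | h2 <;> rcases h3 with h3 | h3 | h3 <;>
    rw [h1, h2, h3] at key1 key2 key3 <;>
    first
      | exact ⟨h1, h2, .inl h3⟩
      | exact ⟨h1, h2, .inr h3⟩
      | (exfalso; linarith)

theorem inner_of_ne_H₄ (hΓ : IsGoldenRootSystem Λ Γ) {a b c d e : V} (ha : a ∈ Γ) (hb : b ∈ Γ)
    (hc : c ∈ Γ) (hd : d ∈ Γ) (he : e ∈ Γ) (hae : a ≠ e) (hbe : b ≠ e) (hce : c ≠ e)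
    (hde : d ≠ e) (hab : inner ℝ a b = -φ) (hac : inner ℝ a c = (0 : ℝ))
    (hbc : inner ℝ b c = (-1 : ℝ)) (had : inner ℝ a d = (0 : ℝ)) (hbd : inner ℝ b d = (0 : ℝ))
    (hcd : inner ℝ c d = (-1 : ℝ)) :
    inner ℝ a e = (0 : ℝ) ∧ inner ℝ b e = (0 : ℝ) ∧ inner ℝ c e = (0 : ℝ) ∧
      inner ℝ d e = (0 : ℝ) := by
  have na := hΓ.inner_self a ha
  have nb := hΓ.inner_self b hb
  have nc := hΓ.inner_self c hc
  have nd := hΓ.inner_self d hd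
  have ne := hΓ.inner_self e he
  obtain ⟨h1, h2, h3⟩ := hΓ.inner_of_ne_H₃ ha hb hc he hae hbe hce hab hac hbc
  -- The first vector excludes a branch at c, the second a prolongation of the path beyond d.
  have key1 := inner_five_nonneg na nb nc nd ne (3 / 2 * φ) 3 2 1 1
  have key2 := inner_five_nonneg na nb nc nd ne (2 * φ) 4 3 2 1
  have h4 := hΓ.inner_of_ne d hd e he hde
  obtain ⟨p2, p3, -, -⟩ := golden_pow
  obtain ⟨q1, q2⟩ := golden_bounds
  rw [hab, hac, had, hbc, hbd, hcd, h1, h2] at key1 key2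
  generalize φ = p at *
  refine ⟨h1, h2, ?_⟩
  rcases h3 with h3 | h3 <;> rcases h4 with h4 | h4 | h4 <;> rw [h3, h4] at key1 key2 <;>
    first
      | exact ⟨h3, h4⟩
      | (exfalso; linarith)

/-- Used to grow a component from an edge labelled 5: a proper non-empty subset of a component has a
neighbour in the rest. -/
theorem eq_or_exists_adj {S : Set V} (hC : IsComponent (innerₗ V) Γ C)
    (hΓ : IsGoldenRootSystem Λ Γ) (hSC : S ⊆ C) (hS : S.Nonempty) :
    S = C ∨ ∃ s ∈ S, ∃ x ∈ C, x ∉ S ∧ inner ℝ s x ≠ (0 : ℝ) := by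
  obtain ⟨hCΓ, -, hclosed, hmin⟩ :=
    (isComponent_iff (isEuclidean_innerₗ V) hΓ.hasOrthogonalEntries C).1 hC
  by_cases h1 : IsAdjClosed (innerₗ V) Γ S
  · exact .inl (hmin S hSC hS h1)
  · rw [IsAdjClosed] at h1
    push Not at h1
    obtain ⟨s, hs, x, hx, hsx, hxS⟩ := h1
    exact .inr ⟨s, hs, x, hclosed s (hSC hs) x hx hsx, hxS, hsx⟩

/-- `CoxeterMatrix.I m` has label m + 2, so `I 3` is the type I₂(5). -/
theorem hasType_I_of_eq (hΓ : IsGoldenRootSystem Λ Γ) {a b : V} (ha : a ∈ Γ) (hb : b ∈ Γ)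
    (hab : inner ℝ a b = -φ) : HasType (innerₗ V) {a, b} (CoxeterMatrix.I 3) := by
  have hB := isEuclidean_innerₗ V
  have na := innerₗ_self_eq_two (hΓ.inner_self a ha)
  have nb := innerₗ_self_eq_two (hΓ.inner_self b hb)
  have ea := hΓ.entry_self ha
  have eb := hΓ.entry_self hb
  have hab' := (real_inner_comm _ _).trans hab
  have e1 := coxeterEntry_eq_five hB na nb hab
  have e2 := coxeterEntry_eq_five hB nb na hab'
  have hr : ({a, b} : Set V) = Set.range ![a, b] := by
    simp only [Matrix.range_cons, Matrix.range_empty, Set.union_empty, Set.insert_eq]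
  rw [hr]
  refine hasType_range hB ?_ ?_
  · intro i
    fin_cases i
    exacts [hΓ.isRootSystem.ne_zero (hΓ.isSimpleSystem.subset ha),
      hΓ.isRootSystem.ne_zero (hΓ.isSimpleSystem.subset hb)]
  · intro i j
    fin_cases i <;> fin_cases j
    exacts [ea, e1, e2, eb]

theorem hasType_H₃_of_eq (hΓ : IsGoldenRootSystem Λ Γ) {a b c : V} (ha : a ∈ Γ) (hb : b ∈ Γ)
    (hc : c ∈ Γ) (hab : inner ℝ a b = -φ) (hac : inner ℝ a c = (0 : ℝ))
    (hbc : inner ℝ b c = (-1 : ℝ)) : HasType (innerₗ V) {c, b, a} CoxeterMatrix.H₃ := by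
  have hB := isEuclidean_innerₗ V
  have na := innerₗ_self_eq_two (hΓ.inner_self a ha)
  have nb := innerₗ_self_eq_two (hΓ.inner_self b hb)
  have nc := innerₗ_self_eq_two (hΓ.inner_self c hc)
  have hba := (real_inner_comm _ _).trans hab
  have hca := (real_inner_comm _ _).trans hac
  have hcb := (real_inner_comm _ _).trans hbc
  have hr : ({c, b, a} : Set V) = Set.range ![c, b, a] := by
    simp only [Matrix.range_cons, Matrix.range_empty, Set.union_empty, Set.insert_eq]
  rw [hr]
  refine hasType_range hB ?_ ?_
  · intro i
    fin_cases i
    exacts [hΓ.isRootSystem.ne_zero (hΓ.isSimpleSystem.subset hc),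
      hΓ.isRootSystem.ne_zero (hΓ.isSimpleSystem.subset hb),
      hΓ.isRootSystem.ne_zero (hΓ.isSimpleSystem.subset ha)]
  · intro i j
    fin_cases i <;> fin_cases j
    exacts [hΓ.entry_self hc, coxeterEntry_eq_three hB nc nb hcb, coxeterEntry_eq_two hB nc na hca,
      coxeterEntry_eq_three hB nb nc hbc, hΓ.entry_self hb, coxeterEntry_eq_five hB nb na hba,
      coxeterEntry_eq_two hB na nc hac, coxeterEntry_eq_five hB na nb hab, hΓ.entry_self ha]

theorem hasType_H₄_of_eq (hΓ : IsGoldenRootSystem Λ Γ) {a b c d : V} (ha : a ∈ Γ) (hb : b ∈ Γ)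
    (hc : c ∈ Γ) (hd : d ∈ Γ) (hab : inner ℝ a b = -φ) (hac : inner ℝ a c = (0 : ℝ))
    (hbc : inner ℝ b c = (-1 : ℝ)) (had : inner ℝ a d = (0 : ℝ)) (hbd : inner ℝ b d = (0 : ℝ))
    (hcd : inner ℝ c d = (-1 : ℝ)) :
    HasType (innerₗ V) {d, c, b, a} CoxeterMatrix.H₄ := by
  have hB := isEuclidean_innerₗ V
  have na := innerₗ_self_eq_two (hΓ.inner_self a ha)
  have nb := innerₗ_self_eq_two (hΓ.inner_self b hb)
  have nc := innerₗ_self_eq_two (hΓ.inner_self c hc)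
  have nd := innerₗ_self_eq_two (hΓ.inner_self d hd)
  have hba := (real_inner_comm _ _).trans hab
  have hca := (real_inner_comm _ _).trans hac
  have hcb := (real_inner_comm _ _).trans hbc
  have hda := (real_inner_comm _ _).trans had
  have hdb := (real_inner_comm _ _).trans hbd
  have hdc := (real_inner_comm _ _).trans hcd
  have hr : ({d, c, b, a} : Set V) = Set.range ![d, c, b, a] := by
    simp only [Matrix.range_cons, Matrix.range_empty, Set.union_empty, Set.insert_eq]
  rw [hr]
  refine hasType_range hB ?_ ?_
  · intro i
    fin_cases i
    exacts [hΓ.isRootSystem.ne_zero (hΓ.isSimpleSystem.subset hd),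
      hΓ.isRootSystem.ne_zero (hΓ.isSimpleSystem.subset hc),
      hΓ.isRootSystem.ne_zero (hΓ.isSimpleSystem.subset hb),
      hΓ.isRootSystem.ne_zero (hΓ.isSimpleSystem.subset ha)]
  · intro i j
    fin_cases i <;> fin_cases j
    exacts [hΓ.entry_self hd, coxeterEntry_eq_three hB nd nc hdc, coxeterEntry_eq_two hB nd nb hdb,
      coxeterEntry_eq_two hB nd na hda,
      coxeterEntry_eq_three hB nc nd hcd, hΓ.entry_self hc, coxeterEntry_eq_three hB nc nb hcb,
      coxeterEntry_eq_two hB nc na hca,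
      coxeterEntry_eq_two hB nb nd hbd, coxeterEntry_eq_three hB nb nc hbc, hΓ.entry_self hb,
      coxeterEntry_eq_five hB nb na hba,
      coxeterEntry_eq_two hB na nd had, coxeterEntry_eq_two hB na nc hac,
      coxeterEntry_eq_five hB na nb hab, hΓ.entry_self ha]

theorem hasType_of_adj_five (hΓ : IsGoldenRootSystem Λ Γ) (hC : IsComponent (innerₗ V) Γ C)
    (hCΓ : C ⊆ Γ) {a b c : V} (ha : a ∈ C) (hb : b ∈ C) (hc : c ∈ C) (hca : a ≠ c) (hcb : b ≠ c)
    (hab : inner ℝ a b = -φ) (hbc0 : inner ℝ b c ≠ (0 : ℝ)) :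
    HasType (innerₗ V) C CoxeterMatrix.H₄ ∨ HasType (innerₗ V) C CoxeterMatrix.H₃ := by
  obtain ⟨hac, hbc⟩ := hΓ.inner_of_adj_five (hCΓ ha) (hCΓ hb) (hCΓ hc) hca hcb hab hbc0
  -- Any further vertex can only be attached to c, by a simple edge; after that no vertex can be
  -- added to the resulting H₄.
  rcases eq_or_exists_adj (S := {c, b, a}) hC hΓ (by
    rintro x (rfl | rfl | rfl) <;> assumption) ⟨c, by simp⟩ with h1 | ⟨s, hs, d, hd, hdS, hsd⟩
  · exact .inr (h1 ▸ hΓ.hasType_H₃_of_eq (hCΓ ha) (hCΓ hb) (hCΓ hc) hab hac hbc)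
  · left
    simp only [Set.mem_insert_iff, Set.mem_singleton_iff, not_or] at hdS
    obtain ⟨had, hbd, hcd⟩ := hΓ.inner_of_ne_H₃ (hCΓ ha) (hCΓ hb) (hCΓ hc) (hCΓ hd)
      (Ne.symm hdS.2.2) (Ne.symm hdS.2.1) (Ne.symm hdS.1) hab hac hbc
    replace hcd : inner ℝ c d = (-1 : ℝ) := by
      rcases hs with rfl | rfl | rfl
      · exact hcd.resolve_left hsd
      · exact absurd hbd hsd
      · exact absurd had hsd
    rcases eq_or_exists_adj (S := {d, c, b, a}) hC hΓ (by
      rintro x (rfl | rfl | rfl | rfl) <;> assumption) ⟨c, by simp⟩ with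
        h1 | ⟨s, hs, e, he, heS, hse⟩
    · exact h1 ▸ hΓ.hasType_H₄_of_eq (hCΓ ha) (hCΓ hb) (hCΓ hc) (hCΓ hd) hab hac hbc had hbd hcd
    · exfalso
      simp only [Set.mem_insert_iff, Set.mem_singleton_iff, not_or] at heS
      obtain ⟨hae, hbe, hce, hde⟩ := hΓ.inner_of_ne_H₄ (hCΓ ha) (hCΓ hb) (hCΓ hc) (hCΓ hd)
        (hCΓ he) (Ne.symm heS.2.2.2) (Ne.symm heS.2.2.1) (Ne.symm heS.2.1) (Ne.symm heS.1)
        hab hac hbc had hbd hcd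
      rcases hs with rfl | rfl | rfl | rfl
      exacts [hse hde, hse hce, hse hbe, hse hae]

theorem component_type (hΓ : IsGoldenRootSystem Λ Γ) (hC : IsComponent (innerₗ V) Γ C) :
    HasType (innerₗ V) C CoxeterMatrix.H₄ ∨ HasType (innerₗ V) C CoxeterMatrix.H₃ ∨
      HasType (innerₗ V) C (CoxeterMatrix.I 3) ∨ IsSimplyLaced (innerₗ V) C := by
  have hCΓ : C ⊆ Γ :=
    ((isComponent_iff (isEuclidean_innerₗ V) hΓ.hasOrthogonalEntries C).1 hC).1
  by_cases hsl : IsSimplyLaced (innerₗ V) C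
  · exact .inr (.inr (.inr hsl))
  rw [IsSimplyLaced] at hsl
  push Not at hsl
  obtain ⟨a, ha, b, hb, hne, h2, h3⟩ := hsl
  have hab : inner ℝ a b = -φ := by
    rcases hΓ.entry_cases (hCΓ ha) (hCΓ hb) hne with h | h | h
    exacts [absurd h.2 h2, absurd h.2 h3, h.1]
  have hba := (real_inner_comm _ _).trans hab
  rcases eq_or_exists_adj (S := {a, b}) hC hΓ (by
    rintro x (rfl | rfl) <;> assumption) ⟨a, by simp⟩ with h1 | ⟨s, hs, c, hc, hcS, hsc⟩
  · exact .inr (.inr (.inl (h1 ▸ hΓ.hasType_I_of_eq (hCΓ ha) (hCΓ hb) hab)))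
  · simp only [Set.mem_insert_iff, Set.mem_singleton_iff, not_or] at hcS
    rw [← or_assoc]
    left
    rcases hs with rfl | rfl
    · exact hΓ.hasType_of_adj_five hC hCΓ hb ha hc (Ne.symm hcS.2) (Ne.symm hcS.1) hba hsc
    · exact hΓ.hasType_of_adj_five hC hCΓ ha hb hc (Ne.symm hcS.1) (Ne.symm hcS.2) hab hsc

end IsGoldenRootSystem

end Classification

/-! ### The Coxeter graph of Γ ∪ τΓ. -/

section CoxeterDoubling

variable {V : Type*} [NormedAddCommGroup V] [InnerProductSpace ℝ V] {Φ P Λ Γ C : Set V}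

/-- The entry of the Coxeter matrix of `Γ ∪ τΓ` at `α, β` or at `τα, τβ` or at `α, τβ` in terms of
the entry of the Coxeter matrix of `Γ` at `α, β`. -/
def foldEntry {ι : Type*} (M : ι → ι → ℕ) : ι ⊕ ι → ι ⊕ ι → ℕ
  | .inl i, .inl j => if M i j = 5 then 2 else M i j
  | .inl i, .inr j => if M i j = 5 then 3 else 2
  | .inr i, .inl j => if M i j = 5 then 3 else 2
  | .inr i, .inr j => if M i j = 5 then 3 else M i j

namespace IsGoldenRootSystem

variable (h : IsGoldenRootSystem Φ P)

theorem simple_cases (hΓ : IsGoldenRootSystem Λ Γ)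
    {u v : rootLattice P} (hu : (u : V) ∈ Γ) (hv : (v : V) ∈ Γ) :
    ∃ a b : ℤ, inner ℝ (u : V) (v : V) = a + b * φ ∧
      ((u = v ∧ a = 2 ∧ b = 0 ∧ coxeterEntry (innerₗ V) (u : V) v = 1) ∨
        u ≠ v ∧ (a = 0 ∧ b = 0 ∧ coxeterEntry (innerₗ V) (u : V) v = 2 ∨
          a = -1 ∧ b = 0 ∧ coxeterEntry (innerₗ V) (u : V) v = 3 ∨
          a = 0 ∧ b = -1 ∧ coxeterEntry (innerₗ V) (u : V) v = 5)) := by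
  by_cases huv : u = v
  · subst huv
    exact ⟨2, 0, (hΓ.inner_self u hu).trans (by simp), .inl ⟨rfl, rfl, rfl, hΓ.entry_self hu⟩⟩
  · rcases hΓ.entry_cases hu hv fun h0 => huv (Subtype.ext h0) with h1 | h1 | h1
    · exact ⟨0, 0, h1.1.trans (by simp), .inr ⟨huv, .inl ⟨rfl, rfl, h1.2⟩⟩⟩
    · exact ⟨-1, 0, h1.1.trans (by simp), .inr ⟨huv, .inr (.inl ⟨rfl, rfl, h1.2⟩)⟩⟩
    · exact ⟨0, -1, h1.1.trans (by simp), .inr ⟨huv, .inr (.inr ⟨rfl, rfl, h1.2⟩)⟩⟩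

theorem entry_of_form {x y : RealLattice P} (hx : h.realForm x x = 2) (hy : h.realForm y y = 2) :
    (h.realForm x y = 0 → coxeterEntry h.realForm x y = 2) ∧
      (h.realForm x y = -1 → coxeterEntry h.realForm x y = 3) :=
  ⟨coxeterEntry_eq_two h.isEuclidean hx hy, coxeterEntry_eq_three h.isEuclidean hx hy⟩

theorem entry_of_form_two {x : RealLattice P} (hx : h.realForm x x = 2) :
    coxeterEntry h.realForm x x = 1 := by
  refine coxeterEntry_self h.isEuclidean ?_
  rintro rfl
  simp at hx

/-- For ⟨u, v⟩ = -1 the copies u, v and τu, τv carry one edge each and there is no cross edge. For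
⟨u, v⟩ = -φ the edge u, v disappears, and the edges u, τv and τu, v and τu, τv have label 3. -/
theorem entry_doubling (hΛΦ : Λ ⊆ Φ) (hΓ : IsGoldenRootSystem Λ Γ) {u v : rootLattice P}
    (hu : (u : V) ∈ Γ) (hv : (v : V) ∈ Γ) {m : ℕ} (hm : coxeterEntry (innerₗ V) (u : V) v = m) :
    coxeterEntry h.realForm (incl P u) (incl P v) = (if m = 5 then 2 else m) ∧
    coxeterEntry h.realForm (incl P u) (incl P (tauEnd P v)) = (if m = 5 then 3 else 2) ∧
    coxeterEntry h.realForm (incl P (tauEnd P u)) (incl P v) = (if m = 5 then 3 else 2) ∧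
    coxeterEntry h.realForm (incl P (tauEnd P u)) (incl P (tauEnd P v)) =
      (if m = 5 then 3 else m) := by
  have huΦ := hΛΦ (hΓ.isSimpleSystem.subset hu)
  have hvΦ := hΛΦ (hΓ.isSimpleSystem.subset hv)
  have uu := h.form_incl_self huΦ
  have vv := h.form_incl_self hvΦ
  have tu := h.form_tau_self huΦ
  have tv := h.form_tau_self hvΦ
  obtain ⟨a, b, hab, hc⟩ := simple_cases hΓ hu hv
  have f1 := h.form_incl hab
  have f2 := h.form_incl_tau hab
  have f3 := h.form_tau_incl hab
  have f4 := h.form_tau_tau hab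
  rcases hc with ⟨rfl, rfl, rfl, he⟩ | ⟨-, ⟨rfl, rfl, he⟩ | ⟨rfl, rfl, he⟩ | ⟨rfl, rfl, he⟩⟩ <;>
    rw [he] at hm <;> subst hm <;> push_cast at f1 f2 f3 f4 <;> norm_num at f4 <;>
    norm_num only [if_true, if_false]
  · exact ⟨h.entry_of_form_two uu, (h.entry_of_form uu tu).1 f2, (h.entry_of_form tu uu).1 f3,
      h.entry_of_form_two tu⟩
  · exact ⟨(h.entry_of_form uu vv).1 f1, (h.entry_of_form uu tv).1 f2, (h.entry_of_form tu vv).1 f3,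
      (h.entry_of_form tu tv).1 f4⟩
  · exact ⟨(h.entry_of_form uu vv).2 f1, (h.entry_of_form uu tv).1 f2, (h.entry_of_form tu vv).1 f3,
      (h.entry_of_form tu tv).2 f4⟩
  · exact ⟨(h.entry_of_form uu vv).1 f1, (h.entry_of_form uu tv).2 f2, (h.entry_of_form tu vv).2 f3,
      (h.entry_of_form tu tv).2 f4⟩

theorem doubling_entry_cases (hΛΦ : Λ ⊆ Φ) (hΓ : IsGoldenRootSystem Λ Γ) {x y : RealLattice P}
    (hx : x ∈ doubling P Γ) (hy : y ∈ doubling P Γ) (hne : x ≠ y) :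
    (h.realForm x y = 0 ∧ coxeterEntry h.realForm x y = 2) ∨
      (h.realForm x y = -1 ∧ coxeterEntry h.realForm x y = 3) := by
  suffices hf : h.realForm x y = 0 ∨ h.realForm x y = -1 by
    have hsub : ∀ z ∈ doubling P Γ, h.realForm z z = 2 := by
      intro z hz
      obtain ⟨u, hu, rfl | rfl⟩ := mem_doubling.1 hz
      exacts [h.form_incl_self (hΛΦ (hΓ.isSimpleSystem.subset hu)),
        h.form_tau_self (hΛΦ (hΓ.isSimpleSystem.subset hu))]
    have h1 := h.entry_of_form (hsub x hx) (hsub y hy)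
    exact hf.imp (fun h0 => ⟨h0, h1.1 h0⟩) (fun h0 => ⟨h0, h1.2 h0⟩)
  obtain ⟨u, hu, hux⟩ := mem_doubling.1 hx
  obtain ⟨v, hv, hvy⟩ := mem_doubling.1 hy
  obtain ⟨a, b, hab, hc⟩ := simple_cases hΓ hu hv
  have f1 := h.form_incl hab
  have f2 := h.form_incl_tau hab
  have f3 := h.form_tau_incl hab
  have f4 := h.form_tau_tau hab
  rcases hc with ⟨rfl, rfl, rfl, -⟩ | ⟨-, ⟨rfl, rfl, -⟩ | ⟨rfl, rfl, -⟩ | ⟨rfl, rfl, -⟩⟩ <;>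
    rcases hux with rfl | rfl <;> rcases hvy with rfl | rfl <;>
    first
      | exact absurd rfl hne
      | (rw [f1]; norm_num)
      | (rw [f2]; norm_num)
      | (rw [f3]; norm_num)
      | (rw [f4]; norm_num)

theorem hasOrthogonalEntries_doubling (hΛΦ : Λ ⊆ Φ) (hΓ : IsGoldenRootSystem Λ Γ) :
    HasOrthogonalEntries h.realForm (doubling P Γ) := by
  intro x hx y hy hne
  rcases h.doubling_entry_cases hΛΦ hΓ hx hy hne with h1 | h1 <;> rw [h1.1, h1.2] <;> norm_num

/-- The map σ labels the vertices of the target diagram by the two copies of C; the comparison of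
matrices makes it injective. -/
theorem hasType_doubling (hΛΦ : Λ ⊆ Φ) (hΓ : IsGoldenRootSystem Λ Γ) (hCΓ : C ⊆ Γ)
    {ι κ : Type*} {M : CoxeterMatrix ι} {M' : CoxeterMatrix κ} (hC : HasType (innerₗ V) C M)
    (σ : κ → ι ⊕ ι) (hσ : Function.Surjective σ)
    (hM : ∀ i j, foldEntry M (σ i) (σ j) = M' i j) : HasType h.realForm (doubling P C) M' := by
  obtain ⟨e, he⟩ := hC
  have hCU : C ⊆ rootLattice P := fun v hv =>
    h.root_mem_rootLattice (hΛΦ (hΓ.isSimpleSystem.subset (hCΓ hv)))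
  have hr : doubling P C = Set.range (doublingFamily hCU ∘ Sum.map e e ∘ σ) := by
    rw [(((Sum.map_surjective.2 ⟨e.surjective, e.surjective⟩).comp hσ).range_comp _),
      range_doublingFamily]
  have hmem : ∀ i, doublingFamily hCU i ∈ doubling P Γ := fun i => by
    have h1 : doublingFamily hCU i ∈ doubling P C := range_doublingFamily hCU ▸ ⟨i, rfl⟩
    exact (h.doubling_subset_iff ((hCΓ.trans hΓ.isSimpleSystem.subset).trans hΛΦ)
      (hΓ.isSimpleSystem.subset.trans hΛΦ)).2 hCΓ h1
  rw [hr]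
  refine hasType_range h.isEuclidean (fun i h0 => ?_) fun i j => ?_
  · have h1 := (h.isRootSystem_doubling hΛΦ hΓ.isRootSystem).zero_notMem
    refine h1 ((h.doubling_subset_iff (hΓ.isSimpleSystem.subset.trans hΛΦ) hΛΦ).2
      hΓ.isSimpleSystem.subset ?_)
    rw [← h0]
    exact hmem _
  · rw [← hM]
    have key := fun i j => h.entry_doubling hΛΦ hΓ (u := ⟨e i, hCU (e i).2⟩)
      (v := ⟨e j, hCU (e j).2⟩) (hCΓ (e i).2) (hCΓ (e j).2) (he i j)
    simp only [Function.comp_apply]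
    rcases σ i with i | i <;> rcases σ j with j | j
    exacts [(key i j).1, (key i j).2.1, (key i j).2.2.1, (key i j).2.2.2]

/-! ### Components -/

theorem isAdjClosed_doubling
    (hC : IsAdjClosed (innerₗ V) Γ C) : IsAdjClosed h.realForm (doubling P Γ) (doubling P C) := by
  intro x hx y hy hxy
  obtain ⟨u, hu, hux⟩ := mem_doubling.1 hx
  obtain ⟨v, hv, hvy⟩ := mem_doubling.1 hy
  refine mem_doubling.2 ⟨v, hC u hu v hv fun h0 => hxy ?_, hvy⟩
  have h1 : inner ℝ (u : V) (v : V) = ((0 : ℤ) : ℝ) + ((0 : ℤ) : ℝ) * φ := h0.trans (by simp)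
  rcases hux with rfl | rfl <;> rcases hvy with rfl | rfl
  · simpa using h.form_incl h1
  · simpa using h.form_incl_tau h1
  · simpa using h.form_tau_incl h1
  · simpa using h.form_tau_tau h1

/-- The path u - τv - τu links the two copies, so both u and τu lie in T. From there both copies of
each vertex are reached along C. -/
theorem doubling_subset_of_isAdjClosed (hΓ : IsGoldenRootSystem Λ Γ) (hΛΦ : Λ ⊆ Φ)
    (hC : IsComponent (innerₗ V) Γ C) {u v : rootLattice P} (hu : (u : V) ∈ C) (hv : (v : V) ∈ C)
    (huv : inner ℝ (u : V) (v : V) = -φ) {T : Set (RealLattice P)}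
    (hT : IsAdjClosed h.realForm (doubling P Γ) T) (huT : incl P u ∈ T) : doubling P C ⊆ T := by
  obtain ⟨hCΓ, -, hclosed, hmin⟩ :=
    (isComponent_iff (isEuclidean_innerₗ V) hΓ.hasOrthogonalEntries C).1 hC
  have huv' : inner ℝ (u : V) (v : V) = ((0 : ℤ) : ℝ) + ((-1 : ℤ) : ℝ) * φ := huv.trans (by simp)
  have hvu' := (real_inner_comm _ _).trans huv'
  have tv : incl P (tauEnd P v) ∈ T := hT _ huT _ (incl_tau_mem_doubling (hCΓ hv))
    (by rw [h.form_incl_tau huv']; norm_num)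
  have tu : incl P (tauEnd P u) ∈ T := hT _ tv _ (incl_tau_mem_doubling (hCΓ hu))
    (by rw [h.form_tau_tau hvu']; norm_num)
  -- The vertices with both copies in T form a neighbour-closed set: an edge labelled 3 preserves
  -- the copies, an edge labelled 5 can be followed by switching them.
  set S : Set V := {γ | γ ∈ C ∧ ∀ w : rootLattice P, (w : V) = γ →
    incl P w ∈ T ∧ incl P (tauEnd P w) ∈ T} with hS
  have hSC : S = C := by
    refine hmin S (fun γ hγ => hγ.1) ⟨u, hu, fun w hw => ?_⟩ ?_
    · rw [Subtype.ext hw]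
      exact ⟨huT, tu⟩
    · rintro γ ⟨hγC, hγ⟩ δ hδ hγδ
      have hδC := hclosed γ hγC δ hδ hγδ
      refine ⟨hδC, fun w hw => ?_⟩
      subst hw
      set z : rootLattice P := ⟨γ, h.root_mem_rootLattice
        (hΛΦ (hΓ.isSimpleSystem.subset (hCΓ hγC)))⟩
      have hz := hγ z rfl
      have mw := incl_mem_doubling hδ
      have mtw := incl_tau_mem_doubling hδ
      obtain ⟨a, b, hab, hc⟩ := simple_cases hΓ (u := z) (v := w) (hCΓ hγC) hδ
      rcases hc with ⟨rfl, -⟩ | ⟨-, ⟨rfl, rfl, -⟩ | ⟨rfl, rfl, -⟩ | ⟨rfl, rfl, -⟩⟩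
      · exact hz
      · exact absurd (hab.trans (by simp)) hγδ
      · exact ⟨hT _ hz.1 _ mw (by rw [h.form_incl hab]; norm_num),
          hT _ hz.2 _ mtw (by rw [h.form_tau_tau hab]; norm_num)⟩
      · exact ⟨hT _ hz.2 _ mw (by rw [h.form_tau_incl hab]; norm_num),
          hT _ hz.1 _ mtw (by rw [h.form_incl_tau hab]; norm_num)⟩
  intro x hx
  obtain ⟨w, hw, hwx⟩ := mem_doubling.1 hx
  have h1 := (hSC.ge hw).2 w rfl
  rcases hwx with rfl | rfl
  exacts [h1.1, h1.2]

theorem isComponent_doubling (hΛΦ : Λ ⊆ Φ) (hΓ : IsGoldenRootSystem Λ Γ)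
    (hC : IsComponent (innerₗ V) Γ C) {α β : V} (hα : α ∈ C) (hβ : β ∈ C)
    (hαβ : coxeterEntry (innerₗ V) α β = 5) :
    IsComponent h.realForm (doubling P Γ) (doubling P C) := by
  obtain ⟨hCΓ, -, hclosed, -⟩ :=
    (isComponent_iff (isEuclidean_innerₗ V) hΓ.hasOrthogonalEntries C).1 hC
  have hinner := hΓ.inner_eq_of_entry_eq_five (hCΓ hα) (hCΓ hβ) hαβ
  have hΓΦ := hΓ.isSimpleSystem.subset.trans hΛΦ
  set u : rootLattice P := ⟨α, h.root_mem_rootLattice (hΓΦ (hCΓ hα))⟩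
  set v : rootLattice P := ⟨β, h.root_mem_rootLattice (hΓΦ (hCΓ hβ))⟩
  have hd := h.isAdjClosed_doubling hclosed
  have hsub := (h.doubling_subset_iff (hCΓ.trans hΓΦ) hΓΦ).2 hCΓ
  have hspread := fun T hT huT => h.doubling_subset_of_isAdjClosed hΓ hΛΦ hC (u := u) (v := v)
    hα hβ hinner (T := T) hT huT
  refine (isComponent_iff h.isEuclidean (h.hasOrthogonalEntries_doubling hΛΦ hΓ) _).2
    ⟨hsub, ⟨incl P u, incl_mem_doubling hα⟩, hd, fun T hTC hTne hT => ?_⟩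
  by_cases huT : incl P u ∈ T
  · exact hTC.antisymm (hspread T hT huT)
  · exfalso
    -- By symmetry of the form the complement of T in C ∪ τC is closed as well. It contains u, hence
    -- is everything, so T would be empty.
    have hcompl : IsAdjClosed h.realForm (doubling P Γ) (doubling P C \ T) := by
      rintro s ⟨hs, hsT⟩ x hx hsx
      refine ⟨hd s hs x hx hsx, fun hxT => hsT (hT x hxT s (hsub hs) ?_)⟩
      rwa [h.realForm_symm]
    obtain ⟨t, ht⟩ := hTne
    exact (hspread _ hcompl ⟨incl_mem_doubling hα, huT⟩ (hTC ht)).2 ht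

/-- Covers both copies of a simply laced component: `j` will be u ↦ u or u ↦ τu. A closed part of
the copy pulls back to a closed part of C, so minimality is inherited. -/
theorem isComponent_copy (hΛΦ : Λ ⊆ Φ) (hΓ : IsGoldenRootSystem Λ Γ)
    (hC : IsComponent (innerₗ V) Γ C) (j : rootLattice P → RealLattice P)
    (hj : ∀ u v : rootLattice P, (u : V) ∈ C → (v : V) ∈ Γ → inner ℝ (u : V) (v : V) ≠ (0 : ℝ) →
      h.realForm (j u) (j v) ≠ 0)
    (hjC : ∀ u : rootLattice P, (u : V) ∈ C → j u ∈ doubling P Γ)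
    (hcross : ∀ u : rootLattice P, (u : V) ∈ C → ∀ x ∈ doubling P Γ, h.realForm (j u) x ≠ 0 →
      ∃ v : rootLattice P, (v : V) ∈ C ∧ j v = x) :
    IsComponent h.realForm (doubling P Γ) {x | ∃ u : rootLattice P, (u : V) ∈ C ∧ j u = x} := by
  obtain ⟨hCΓ, ⟨α, hα⟩, hclosed, hmin⟩ :=
    (isComponent_iff (isEuclidean_innerₗ V) hΓ.hasOrthogonalEntries C).1 hC
  have hΓΦ := hΓ.isSimpleSystem.subset.trans hΛΦ
  refine (isComponent_iff h.isEuclidean (h.hasOrthogonalEntries_doubling hΛΦ hΓ) _).2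
    ⟨?_, ⟨j ⟨α, h.root_mem_rootLattice (hΓΦ (hCΓ hα))⟩, _, hα, rfl⟩, ?_, fun T hTC hTne hT => ?_⟩
  · rintro _ ⟨u, hu, rfl⟩
    exact hjC u hu
  · rintro _ ⟨u, hu, rfl⟩ x hx hux
    exact hcross u hu x hx hux
  · refine hTC.antisymm ?_
    set S : Set V := {γ | γ ∈ C ∧ ∀ w : rootLattice P, (w : V) = γ → j w ∈ T} with hS
    have hSC : S = C := by
      refine hmin S (fun γ hγ => hγ.1) ?_ ?_
      · obtain ⟨t, ht⟩ := hTne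
        obtain ⟨u, hu, rfl⟩ := hTC ht
        refine ⟨u, hu, fun w hw => ?_⟩
        rwa [Subtype.ext hw]
      · rintro γ ⟨hγC, hγ⟩ δ hδ hγδ
        have hδC := hclosed γ hγC δ hδ hγδ
        refine ⟨hδC, fun w hw => ?_⟩
        subst hw
        set z : rootLattice P := ⟨γ, h.root_mem_rootLattice (hΓΦ (hCΓ hγC))⟩
        exact hT _ (hγ z rfl) _ (hjC w hδC) (hj z w hγC hδ hγδ)
    rintro _ ⟨w, hw, rfl⟩
    exact (hSC.ge hw).2 w rfl

theorem sameType_copy (hCU : C ⊆ rootLattice P) (j : rootLattice P → RealLattice P)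
    (hinj : Function.Injective j)
    (hj : ∀ u v : rootLattice P, (u : V) ∈ C → (v : V) ∈ C →
      coxeterEntry h.realForm (j u) (j v) = coxeterEntry (innerₗ V) (u : V) v) :
    SameType (innerₗ V) h.realForm C {x | ∃ u : rootLattice P, (u : V) ∈ C ∧ j u = x} := by
  refine ⟨Equiv.ofBijective (fun α : C => ⟨j ⟨α, hCU α.2⟩, _, α.2, rfl⟩) ⟨?_, ?_⟩, ?_⟩
  · intro α β hαβ
    have h1 := congrArg Subtype.val (hinj (congrArg Subtype.val hαβ))
    exact Subtype.ext h1
  · rintro ⟨_, u, hu, rfl⟩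
    exact ⟨⟨u, hu⟩, rfl⟩
  · intro α β
    exact hj _ _ α.2 β.2

/-- The possible inner products of a member of a simply laced component. -/
theorem simplyLaced_cases (hΓ : IsGoldenRootSystem Λ Γ)
    (hC : IsComponent (innerₗ V) Γ C) (hsl : IsSimplyLaced (innerₗ V) C) {u v : rootLattice P}
    (hu : (u : V) ∈ C) (hv : (v : V) ∈ Γ) :
    (inner ℝ (u : V) (v : V) = (0 : ℝ) ∨ (v : V) ∈ C) ∧
      h.realForm (incl P u) (incl P v) = inner ℝ (u : V) (v : V) ∧
      h.realForm (incl P u) (incl P (tauEnd P v)) = 0 ∧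
      h.realForm (incl P (tauEnd P u)) (incl P v) = 0 ∧
      h.realForm (incl P (tauEnd P u)) (incl P (tauEnd P v)) = inner ℝ (u : V) (v : V) ∧
      coxeterEntry (innerₗ V) (u : V) v ≠ 5 := by
  obtain ⟨hCΓ, -, hclosed, -⟩ :=
    (isComponent_iff (isEuclidean_innerₗ V) hΓ.hasOrthogonalEntries C).1 hC
  have hvC : inner ℝ (u : V) (v : V) = (0 : ℝ) ∨ (v : V) ∈ C := by
    by_cases h0 : inner ℝ (u : V) (v : V) = (0 : ℝ)
    · exact .inl h0
    · exact .inr (hclosed u hu v hv h0)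
  obtain ⟨a, b, hab, hc⟩ := simple_cases hΓ (hCΓ hu) hv
  have hb : b = 0 ∧ coxeterEntry (innerₗ V) (u : V) v ≠ 5 := by
    rcases hc with ⟨-, -, hb, he⟩ | ⟨-, ⟨-, hb, he⟩ | ⟨-, hb, he⟩ | ⟨rfl, rfl, he⟩⟩
    · exact ⟨hb, by omega⟩
    · exact ⟨hb, by omega⟩
    · exact ⟨hb, by omega⟩
    · exfalso
      have hne : (u : V) ≠ v := by
        intro h0
        rw [h0, hΓ.entry_self hv] at he
        omega
      rcases hvC with h0 | h0
      · rw [hab] at h0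
        push_cast at h0
        linarith [Real.goldenRatio_pos]
      · rcases hsl _ hu _ h0 hne with h1 | h1 <;> omega
  obtain ⟨rfl, hent⟩ := hb
  refine ⟨hvC, ?_, ?_, ?_, ?_, hent⟩
  · rw [h.form_incl hab, hab]; simp
  · rw [h.form_incl_tau hab]; simp
  · rw [h.form_tau_incl hab]; simp
  · rw [h.form_tau_tau hab, hab]; simp

theorem simplyLaced_component (hΛΦ : Λ ⊆ Φ) (hΓ : IsGoldenRootSystem Λ Γ)
    (hC : IsComponent (innerₗ V) Γ C) (hsl : IsSimplyLaced (innerₗ V) C) :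
    IsComponent h.realForm (doubling P Γ) (embed P C) ∧
      IsComponent h.realForm (doubling P Γ) (embed P ((fun v : V => φ • v) '' C)) ∧
      embed P C ≠ embed P ((fun v : V => φ • v) '' C) ∧
      SameType (innerₗ V) h.realForm C (embed P C) ∧
      SameType (innerₗ V) h.realForm C (embed P ((fun v : V => φ • v) '' C)) := by
  have hinfo := fun {u v : rootLattice P} => h.simplyLaced_cases hΓ hC hsl (u := u) (v := v)
  obtain ⟨hCΓ, ⟨α, hα⟩, -, -⟩ :=
    (isComponent_iff (isEuclidean_innerₗ V) hΓ.hasOrthogonalEntries C).1 hC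
  have hΓΦ := hΓ.isSimpleSystem.subset.trans hΛΦ
  have hCU : C ⊆ rootLattice P := fun v hv => h.root_mem_rootLattice (hΓΦ (hCΓ hv))
  have e1 : embed P C = {x | ∃ u : rootLattice P, (u : V) ∈ C ∧ incl P u = x} := rfl
  have e2 : embed P ((fun v : V => φ • v) '' C) =
      {x | ∃ u : rootLattice P, (u : V) ∈ C ∧ incl P (tauEnd P u) = x} :=
    Set.ext fun x => mem_embed_smul
  have hne : embed P C ≠ embed P ((fun v : V => φ • v) '' C) := by
    intro h0
    have h1 : incl P ⟨α, hCU hα⟩ ∈ embed P C := ⟨_, hα, rfl⟩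
    rw [h0, e2] at h1
    obtain ⟨u, hu, h2⟩ := h1
    exact h.incl_ne_incl_tau (u := ⟨α, hCU hα⟩) (hΓΦ (hCΓ hα)) (hΓΦ (hCΓ hu)) h2.symm
  refine ⟨?_, ?_, hne, ?_, ?_⟩
  · rw [e1]
    refine h.isComponent_copy hΛΦ hΓ hC (incl P) (fun u v hu hv huv => ?_)
      (fun u hu => incl_mem_doubling (hCΓ hu)) fun u hu x hx hux => ?_
    · rwa [(hinfo hu hv).2.1]
    · obtain ⟨v, hv, rfl | rfl⟩ := mem_doubling.1 hx
      · rw [(hinfo hu hv).2.1] at hux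
        exact ⟨v, (hinfo hu hv).1.resolve_left hux, rfl⟩
      · exact absurd (hinfo hu hv).2.2.1 hux
  · rw [e2]
    refine h.isComponent_copy hΛΦ hΓ hC (fun u => incl P (tauEnd P u)) (fun u v hu hv huv => ?_)
      (fun u hu => incl_tau_mem_doubling (hCΓ hu)) fun u hu x hx hux => ?_
    · rwa [(hinfo hu hv).2.2.2.2.1]
    · obtain ⟨v, hv, rfl | rfl⟩ := mem_doubling.1 hx
      · exact absurd (hinfo hu hv).2.2.2.1 hux
      · rw [(hinfo hu hv).2.2.2.2.1] at hux
        exact ⟨v, (hinfo hu hv).1.resolve_left hux, rfl⟩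
  · rw [e1]
    refine h.sameType_copy hCU (incl P) h.incl_injective fun u v hu hv => ?_
    rw [(h.entry_doubling hΛΦ hΓ (hCΓ hu) (hCΓ hv) rfl).1,
      if_neg (hinfo hu (hCΓ hv)).2.2.2.2.2]
  · rw [e2]
    refine h.sameType_copy hCU (fun u => incl P (tauEnd P u))
      (h.incl_injective.comp tauEnd_injective) fun u v hu hv => ?_
    rw [(h.entry_doubling hΛΦ hΓ (hCΓ hu) (hCΓ hv) rfl).2.2.2,
      if_neg (hinfo hu (hCΓ hv)).2.2.2.2.2]

/-- The vertices of the diagram of type `E₈` in terms of two copies of that of type `H₄`. -/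
def vertexE₈ : Fin 8 → Fin 4 ⊕ Fin 4 :=
  ![.inr 0, .inl 3, .inr 1, .inr 2, .inr 3, .inl 2, .inl 1, .inl 0]

/-- The vertices of the diagram of type `D₆` in terms of two copies of that of type `H₃`. -/
def vertexD₆ : Fin 6 → Fin 3 ⊕ Fin 3 :=
  ![.inl 0, .inl 1, .inr 2, .inr 1, .inl 2, .inr 0]

/-- The vertices of the diagram of type `A₄` in terms of two copies of that of type `I₂(5)`. -/
def vertexA₄ : Fin 4 → Fin 2 ⊕ Fin 2 :=
  ![.inl 0, .inr 1, .inr 0, .inl 1]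

/-- In H₄ the label 5 joins 2 and 3. Unfolding gives the path τ0 - τ1 - τ2 - τ3 - 2 - 1 - 0 with the
vertex 3 attached to τ2. -/
theorem foldEntry_vertexE₈ (i j : Fin 8) :
    foldEntry CoxeterMatrix.H₄ (vertexE₈ i) (vertexE₈ j) = CoxeterMatrix.E₈ i j := by
  fin_cases i <;> fin_cases j <;> rfl

theorem foldEntry_vertexD₆ (i j : Fin 6) :
    foldEntry CoxeterMatrix.H₃ (vertexD₆ i) (vertexD₆ j) = coxeterD6 i j := by
  fin_cases i <;> fin_cases j <;> rfl

theorem foldEntry_vertexA₄ (i j : Fin 4) :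
    foldEntry (CoxeterMatrix.I 3) (vertexA₄ i) (vertexA₄ j) = CoxeterMatrix.A 4 i j := by
  fin_cases i <;> fin_cases j <;> rfl

theorem coxeter_doubling (hΛΦ : Λ ⊆ Φ) (hΓ : IsGoldenRootSystem Λ Γ)
    (hC : IsComponent (innerₗ V) Γ C) {ι κ : Type*} {M : CoxeterMatrix ι} {M' : CoxeterMatrix κ}
    (hM : HasType (innerₗ V) C M) (σ : κ → ι ⊕ ι) (hσ : Function.Surjective σ)
    (hfold : ∀ i j, foldEntry M (σ i) (σ j) = M' i j) {i j : ι} (h5 : M i j = 5) :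
    IsComponent h.realForm (doubling P Γ) (doubling P C) ∧
      HasType h.realForm (doubling P C) M' := by
  have hCΓ : C ⊆ Γ :=
    ((isComponent_iff (isEuclidean_innerₗ V) hΓ.hasOrthogonalEntries C).1 hC).1
  refine ⟨?_, h.hasType_doubling hΛΦ hΓ hCΓ hM σ hσ hfold⟩
  obtain ⟨e, he⟩ := hM
  exact h.isComponent_doubling hΛΦ hΓ hC (e i).2 (e j).2 ((he i j).trans h5)

end IsGoldenRootSystem

end CoxeterDoubling

end GoldenFolding

end

/-! ### Assembly of the statements. -/

theorem proposition5p1 {V : Type*} [NormedAddCommGroup V] [InnerProductSpace ℝ V]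
    [FiniteDimensional ℝ V] (Φ P : Set V) (h : IsGoldenRootSystem Φ P) :
    -- `Ψ = Φ ∪ τΦ` is a simply laced root system with simple system `P ∪ τP`
    (h.realForm.IsSymm ∧ (∀ x : RealLattice P, x ≠ 0 → 0 < h.realForm x x) ∧
      Disjoint (embed P Φ) (embed P ((fun v : V => φ • v) '' Φ)) ∧
      IsRootSystem h.realForm (doubling P Φ) ∧
      IsSimpleSystem (doubling P Φ) (doubling P P) ∧
      (∀ α ∈ doubling P Φ, h.realForm α α = 2) ∧
      (∀ α ∈ doubling P Φ, ∀ β ∈ doubling P Φ, ∃ n : ℤ, h.realForm α β = n) ∧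
      IsSimplyLaced h.realForm (doubling P P)) ∧
    -- (a) the bijection between simple subsystems, and its equivariance
    (Set.BijOn (doubling P)
        {Γ | IsSimpleSubsystem (innerₗ V) Φ Γ}
        {Γ' | IsSimpleSubsystem h.realForm (doubling P Φ) Γ' ∧ IsUnionOfBundles Φ P Γ'} ∧
      ∀ (w : weylGroup (innerₗ V) Φ) (Γ : Set V), IsSimpleSubsystem (innerₗ V) Φ Γ →
        IsSimpleSubsystem (innerₗ V) Φ ((w : V ≃ₗ[ℝ] V) '' Γ) ∧
        doubling P ((w : V ≃ₗ[ℝ] V) '' Γ) = h.act w '' doubling P Γ) ∧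
    -- (b) the fundamental chambers
    (∀ Γ : Set V, IsSimpleSubsystem (innerₗ V) Φ Γ →
      ∀ α : rootLattice P, (α : V) ∈ Φ →
        ((α : V) ∈ chamber (innerₗ V) Γ ↔
          (1 : ℝ) ⊗ₜ[ℤ] (tau • α) ∈ chamber h.realForm (doubling P Γ))) ∧
    -- (c) the Coxeter graphs
    (∀ Γ : Set V, IsSimpleSubsystem (innerₗ V) Φ Γ →
      ∀ C : Set V, IsComponent (innerₗ V) Γ C →
        (HasType (innerₗ V) C CoxeterMatrix.H₄ ∨ HasType (innerₗ V) C CoxeterMatrix.H₃ ∨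
          HasType (innerₗ V) C (CoxeterMatrix.I 3) ∨ IsSimplyLaced (innerₗ V) C) ∧
        (HasType (innerₗ V) C CoxeterMatrix.H₄ →
          IsComponent h.realForm (doubling P Γ) (doubling P C) ∧
          HasType h.realForm (doubling P C) CoxeterMatrix.E₈) ∧
        (HasType (innerₗ V) C CoxeterMatrix.H₃ →
          IsComponent h.realForm (doubling P Γ) (doubling P C) ∧
          HasType h.realForm (doubling P C) coxeterD6) ∧
        (HasType (innerₗ V) C (CoxeterMatrix.I 3) →
          IsComponent h.realForm (doubling P Γ) (doubling P C) ∧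
          HasType h.realForm (doubling P C) (CoxeterMatrix.A 4)) ∧
        (IsSimplyLaced (innerₗ V) C →
          IsComponent h.realForm (doubling P Γ) (embed P C) ∧
          IsComponent h.realForm (doubling P Γ) (embed P ((fun v : V => φ • v) '' C)) ∧
          embed P C ≠ embed P ((fun v : V => φ • v) '' C) ∧
          SameType (innerₗ V) h.realForm C (embed P C) ∧
          SameType (innerₗ V) h.realForm C (embed P ((fun v : V => φ • v) '' C)))) ∧
    -- (d) the induced bijection between root subsystems, and its equivariance
    (Set.BijOn (doubling P)
        {Λ | IsRootSubsystem (innerₗ V) Φ Λ}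
        {Λ' | IsRootSubsystem h.realForm (doubling P Φ) Λ' ∧ IsUnionOfBundles Φ P Λ'} ∧
      (∀ Λ Γ : Set V, IsRootSubsystem (innerₗ V) Φ Λ → IsSimpleSystem Λ Γ →
        IsSimpleSystem (doubling P Λ) (doubling P Γ)) ∧
      ∀ (w : weylGroup (innerₗ V) Φ) (Λ : Set V), IsRootSubsystem (innerₗ V) Φ Λ →
        IsRootSubsystem (innerₗ V) Φ ((w : V ≃ₗ[ℝ] V) '' Λ) ∧
        doubling P ((w : V ≃ₗ[ℝ] V) '' Λ) = h.act w '' doubling P Λ) := by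
  have hB := isEuclidean_innerₗ V
  have hΦ : IsRootSubsystem (innerₗ V) Φ Φ := ⟨subset_rfl, h.isRootSystem⟩
  refine ⟨⟨⟨h.realForm_symm⟩, h.isEuclidean.pos, h.disjoint_embed,
    h.isRootSystem_doubling subset_rfl h.isRootSystem,
    h.isSimpleSystem_doubling hΦ h.isSimpleSystem, fun α hα => h.form_self_of_mem_doubling hα,
    ?_, ?_⟩, ⟨h.bijOn_simpleSubsystem, ?_⟩, ?_, ?_, h.bijOn_rootSubsystem, ?_, ?_⟩
  · intro x hx y hy
    obtain ⟨u, -, hux⟩ := mem_doubling.1 hx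
    obtain ⟨v, -, hvy⟩ := mem_doubling.1 hy
    have key : ∀ u v : rootLattice P, ∃ n : ℤ, h.realForm (incl P u) (incl P v) = n := by
      intro u v
      obtain ⟨a, b, hab⟩ := h.exists_inner_eq u v
      exact ⟨a, h.form_incl hab⟩
    rcases hux with rfl | rfl <;> rcases hvy with rfl | rfl <;> exact key _ _
  · intro x hx y hy hne
    exact (h.doubling_entry_cases subset_rfl h hx hy hne).imp And.right And.right
  · intro w Γ hΓ
    exact ⟨h.isSimpleSubsystem_map w hΓ, h.doubling_map w hΓ.subset⟩
  · intro Γ hΓ α hα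
    exact h.mem_chamber_iff hΓ.subset hα
  · rintro Γ ⟨Λ, hΛ, hS⟩ C hC
    -- Γ satisfies the hypotheses imposed on Π, so the classification of components applies to it.
    have hΓ := h.subsystem hΛ hS
    exact ⟨hΓ.component_type hC,
      fun hM => h.coxeter_doubling hΛ.1 hΓ hC hM IsGoldenRootSystem.vertexE₈ (by decide) IsGoldenRootSystem.foldEntry_vertexE₈
        (i := 2) (j := 3) rfl,
      fun hM => h.coxeter_doubling hΛ.1 hΓ hC hM IsGoldenRootSystem.vertexD₆ (by decide) IsGoldenRootSystem.foldEntry_vertexD₆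
        (i := 1) (j := 2) rfl,
      fun hM => h.coxeter_doubling hΛ.1 hΓ hC hM IsGoldenRootSystem.vertexA₄ (by decide) IsGoldenRootSystem.foldEntry_vertexA₄
        (i := 0) (j := 1) rfl,
      h.simplyLaced_component hΛ.1 hΓ hC⟩
  · intro Λ Γ hΛ hΓ
    exact h.isSimpleSystem_doubling hΛ hΓ
  · intro w Λ hΛ
    exact ⟨h.isRootSubsystem_map w hΛ, h.doubling_map w hΛ.1⟩
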